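/- \textbf{Setting.} There are $n\ge 1$ bidders. Bidder $i$'s type is drawn, independently across bidders, from a distribution $F_i$ on a compact interval $\Theta_i\subset\mathbf R_+$ with a continuous, strictly positive density $f_i$ on $\Theta_i$. Let $F_i^{-1}$ be the quantile function and $\mathrm{MVV}_i(\theta)=\theta-\frac{1-F_i(\theta)}{f_i(\theta)}$ Myerson's virtual value, assumed strictly increasing on $\Theta_i$. Let $h:[0,1]\to\mathbf R$ be twice continuously differentiable with $h',h''>0$ on $(0,1)$. The revenue from selling to type $\theta$ of bidder $i$ with probability $x$ is $J_i(x,\theta)=\mathrm{MVV}_i(\theta)\,h(x)$; put $H_i(x,u)=J_i(x,F_i^{-1}(u))$ for $x,u\in[0,1]$. A \emph{reduced form} is a tuple $\boldsymbol x=(x_1,\dots,x_n)$ of cumulative distribution functions on $[0,1]$ (nonnegative, nondecreasing, right-continuous, $x_i(1)=1$); $x_i(u)$ is the interim winning probability of bidder $i$ with quantile $u$. It is \emph{feasible} if $\prod_{i} u_i+\sum_{i}\int_{u_i}^1x_i(s)\,ds\le 1$ for all $\boldsymbol u\in[0,1]^n$, and \emph{optimal} if it maximizes $\sum_i\int_0^1H_i(x_i(u),u)\,du$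 among feasible reduced forms. The reduced form $\boldsymbol x^{\mathrm M}$ induced by Myerson's auction is given by the interim winning probabilities, as functions of quantiles, when the good is awarded to the bidder with the highest nonnegative $\mathrm{MVV}$. For $0\le\delta\le t$ let $R_i(\delta,t)=\int_0^\delta\frac{\partial}{\partial x}H_i(e^{\tau-t},e^{-\tau})\,d\tau$, so that $\frac{\partial}{\partial\delta}R_i(\delta,t)=\frac{\partial}{\partial x}H_i(e^{\delta-t},e^{-\delta})$ (this formula being the definition of the left-hand side when $t=0$). The environment is \emph{regular} if (A) for every $i$ and $t\ge0$, $R_i(\cdot,t)$ is strictly concave on $[0,t]$; and (B) for every $t\ge 0$ the system $\frac{\partial}{\partial\delta}R_i(\delta_i,t)=p$ for all $i$, $\sum_i\delta_i=t$, has a unique solution $(\boldsymbol\delta^\sharp(t),p^\sharp(t))$ with all $\delta_i\ge0$, each $\delta_i^\sharp$ is strictly increasing in $t$, and $p^\sharp$ is strictly decreasing in $t$. Write $F\ge_{hr}G$ if $(1-F(\theta'))(1-G(\theta))\ge(1-F(\theta))(1-G(\theta'))$ for all $\theta\le\theta'$, and $F\ge_*G$ if $F^{-1}(u')G^{-1}(u)\ge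 F^{-1}(u)G^{-1}(u')$ for all $u\le u'$ in $[0,1]$. \textbf{Proposition 4.} Suppose that the environment is regular and that for all $i$ \[F_1\ge_{hr}F_i\ge_{hr}F_n,\qquad F_n\ge_*F_i\ge_*F_1 .\] Then there is exactly one optimal reduced form $\boldsymbol x^*$, and for all $u\in[0,1]$: \begin{enumerate} \item $x_1^*(u)\ge x_1^{\mathrm M}(u)$ (the strongest bidder is favored by the optimum relative to Myerson's auction); \item $x_n^*(u)\le x_n^{\mathrm M}(u)$ (the weakest bidder is discriminated against by the optimum relative to Myerson's auction). \end{enumerate} -/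

import Mathlib

open Set MeasureTheory

namespace EVAuction

noncomputable section

/-- A type distribution on a compact interval `[lo, hi] ⊆ ℝ₊` with a continuous and strictly
positive density on that interval. -/
structure TypeDist where
  /-- lowest type -/
  lo : ℝ
  /-- highest type -/
  hi : ℝ
  /-- density (only its values on `[lo, hi]` matter) -/
  f : ℝ → ℝ
  lo_nonneg : 0 ≤ lo
  lo_lt_hi : lo < hi
  f_cont : ContinuousOn f (Icc lo hi)
  f_pos : ∀ θ ∈ Icc lo hi, 0 < f θ
  f_integral : ∫ θ in Icc lo hi, f θ = 1

namespace TypeDist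

/-- The cumulative distribution function on all of `ℝ` (`0` below `lo`, `1` above `hi`). -/
def cdf (F : TypeDist) (θ : ℝ) : ℝ := ∫ s in Icc F.lo (min θ F.hi), F.f s

/-- The quantile function `F⁻¹` on `[0, 1]`. -/
def quantile (F : TypeDist) (u : ℝ) : ℝ := sSup {θ | θ ∈ Icc F.lo F.hi ∧ F.cdf θ ≤ u}

/-- Myerson's virtual value `θ - (1 - F(θ)) / f(θ)`, for `θ ∈ [lo, hi]`. -/
def mvv (F : TypeDist) (θ : ℝ) : ℝ := θ - (1 - F.cdf θ) / F.f θ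

/-- The hazard ratio order `F ≥_hr G`. -/
def HrGe (F G : TypeDist) : Prop :=
  ∀ θ θ' : ℝ, θ ≤ θ' →
    (1 - F.cdf θ) * (1 - G.cdf θ') ≤ (1 - F.cdf θ') * (1 - G.cdf θ)

/-- The star order `F ≥_* G`. -/
def StarGe (F G : TypeDist) : Prop :=
  ∀ u ∈ Icc (0 : ℝ) 1, ∀ u' ∈ Icc (0 : ℝ) 1, u ≤ u' →
    F.quantile u * G.quantile u' ≤ F.quantile u' * G.quantile u

end TypeDist

/-- Revenue `J(x, θ) = MVV(θ) h(x)` from selling to type `θ` with probability `x`. -/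
def J (h : ℝ → ℝ) (F : TypeDist) (x θ : ℝ) : ℝ := F.mvv θ * h x

/-- Revenue in the quantile space, `H(x, u) = J(x, F⁻¹(u))`, for `x, u ∈ [0, 1]`. -/
def H (h : ℝ → ℝ) (F : TypeDist) (x u : ℝ) : ℝ := J h F x (F.quantile u)

/-- The partial derivative `∂H/∂x` (one-sided at the end points of `[0, 1]`). -/
def dHdx (h : ℝ → ℝ) (F : TypeDist) (x u : ℝ) : ℝ :=
  derivWithin (fun y => H h F y u) (Icc 0 1) x

/-- The integrand `∂H/∂x (e^(τ-t), e^(-τ))` of `R`, for `0 ≤ τ ≤ t`. It is continuous in `τ`, so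
that its value at `δ` is the marginal revenue `∂R/∂δ (δ, t)`; written in this form it also makes
sense at `t = 0`, where the domain `[0, t]` of `R (·, t)` is a single point. -/
def marginalRevenue (h : ℝ → ℝ) (F : TypeDist) (τ t : ℝ) : ℝ :=
  dHdx h F (Real.exp (τ - t)) (Real.exp (-τ))

/-- `R(δ, t) = ∫₀^δ ∂H/∂x (e^(τ-t), e^(-τ)) dτ`, for `0 ≤ δ ≤ t`. -/
def R (h : ℝ → ℝ) (F : TypeDist) (δ t : ℝ) : ℝ := ∫ τ in (0 : ℝ)..δ, marginalRevenue h F τ t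

/-- `(δ, p)` solves the static system at time `t`: all marginal revenues `∂R_i/∂δ (δ_i, t)` equal
`p`, and the `δ_i ≥ 0` add up to `t`. -/
def SolvesSystem {ι : Type*} [Fintype ι] (h : ℝ → ℝ) (F : ι → TypeDist) (t : ℝ)
    (δ : ι → ℝ) (p : ℝ) : Prop :=
  (∀ i, 0 ≤ δ i) ∧ (∀ i, marginalRevenue h (F i) (δ i) t = p) ∧ ∑ i, δ i = t

/-- A regular environment: each `R_i` is strictly concave in its first argument, and the static
system has a unique solution at each time, with strictly increasing `δ` and strictly
decreasing `p`. -/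
def Regular {ι : Type*} [Fintype ι] (h : ℝ → ℝ) (F : ι → TypeDist) : Prop :=
  (∀ i, ∀ t : ℝ, 0 ≤ t → StrictConcaveOn ℝ (Icc 0 t) (fun δ => R h (F i) δ t)) ∧
  ∃ (δ : ℝ → ι → ℝ) (p : ℝ → ℝ),
    (∀ t : ℝ, 0 ≤ t → SolvesSystem h F t (δ t) (p t) ∧
      ∀ (δ' : ι → ℝ) (p' : ℝ), SolvesSystem h F t δ' p' → δ' = δ t ∧ p' = p t) ∧
    (∀ i, StrictMonoOn (fun t => δ t i) (Ici 0)) ∧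
    StrictAntiOn p (Ici 0)

/-- A cumulative distribution function on the unit interval. -/
def IsCDF (x : ℝ → ℝ) : Prop :=
  MonotoneOn x (Icc 0 1) ∧ (∀ u ∈ Ico (0 : ℝ) 1, ContinuousWithinAt x (Ici u) u) ∧
    0 ≤ x 0 ∧ x 1 = 1

/-- The Border constraints: `∏ u_i + ∑ ∫_{u_i}^1 x_i ≤ 1` for all `u ∈ [0, 1]^n`. -/
def Border {ι : Type*} [Fintype ι] (x : ι → ℝ → ℝ) : Prop :=
  ∀ u : ι → ℝ, (∀ i, u i ∈ Icc (0 : ℝ) 1) →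
    ∏ i, u i + ∑ i, ∫ s in (u i)..1, x i s ≤ 1

/-- Feasible reduced forms (tuples of CDFs satisfying the Border constraints). -/
def Feasible {ι : Type*} [Fintype ι] (x : ι → ℝ → ℝ) : Prop :=
  (∀ i, IsCDF (x i)) ∧ Border x

/-- The auctioneer's expected revenue `∑ ∫₀¹ H_i(x_i(u), u) du`. -/
def revenue {ι : Type*} [Fintype ι] (h : ℝ → ℝ) (F : ι → TypeDist) (x : ι → ℝ → ℝ) : ℝ :=
  ∑ i, ∫ u in (0 : ℝ)..1, H h (F i) (x i u) u

/-- Optimal reduced forms. -/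
def Optimal {ι : Type*} [Fintype ι] (h : ℝ → ℝ) (F : ι → TypeDist) (x : ι → ℝ → ℝ) : Prop :=
  Feasible x ∧ ∀ y : ι → ℝ → ℝ, Feasible y → revenue h F y ≤ revenue h F x

open Classical in
/-- Myerson's auction at the profile `u` of quantiles: the good goes to the bidder with the highest
nonnegative virtual value. -/
def myersonAlloc {ι : Type*} (F : ι → TypeDist) (u : ι → ℝ) (i : ι) : ℝ :=
  if 0 ≤ (F i).mvv ((F i).quantile (u i)) ∧
      ∀ j, j ≠ i → (F j).mvv ((F j).quantile (u j)) < (F i).mvv ((F i).quantile (u i))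
  then 1 else 0

open Classical in
/-- The reduced form induced by Myerson's auction: the expected probability with which bidder `i`
with quantile `w` wins, the quantiles of the others being independent and uniform on `[0, 1]`. -/
def myersonReducedForm {ι : Type*} [Fintype ι] (F : ι → TypeDist) (i : ι) (w : ℝ) : ℝ :=
  ∫ u in Set.pi univ (fun _ : ι => Icc (0 : ℝ) 1), myersonAlloc F (Function.update u i w) i

end

end EVAuction

/-! Put `u = e^(-τ)` and `y = e^(τ-t)`, so that `t` labels the hyperbola `y * u = e^(-t)` and `τ` a
position on it. A winning probability function becomes its crossing path, which says how far each
hyperbola stays below the graph. By `IsCDF.integral_H`, revenue is then a constant plus `∫ e^(-t)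
R(crossing, t) dt`, with no interaction between different `t`.

The Border constraints, evaluated at the quantiles `e^(-crossing)`, bound the cumulative excess of
`∑ crossing` over time (`Border.integral_crossing_le`). Conversely, `∑ crossing ≤ t` at every `t`
suffices for feasibility (`border_of_sum_crossing_le`). Solving the static system pointwise, and
stopping the clock once the price reaches zero, gives paths realized by distribution functions
(`IsPath.exists_isCDF`). The price along the stopped clock is a nonnegative nonincreasing
multiplier, and `verification` combines it with the tangent inequality for the strictly concave `R`.
Strictness forces the crossing paths of any other optimum to agree almost everywhere, and
right-continuity then gives uniqueness.

For the comparison, the system at time zero makes all highest types equal, so the star order ranks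
nonnegative virtual values quantile by quantile. Hence bidder `0` moves fastest and the last bidder
slowest while the price is nonnegative. The price is virtual value times `h'`, and `h'` increases,
so the faster bidder has the lower virtual value on the path. Myerson's winning probability is a
product of the rivals' virtual value CDFs. Comparing it factor by factor with `∏ e^(-δ_j) =
e^(-(t-δ_i))`, the winning probability on the path, gives both inequalities. -/

namespace EVAuction

open Filter Topology

noncomputable section

/-! ### Quantiles and virtual values -/

namespace TypeDist

variable (F : TypeDist)

lemma integrableOn_f : IntegrableOn F.f (Icc F.lo F.hi) := F.f_cont.integrableOn_Icc

lemma cdf_eq_intervalIntegral {θ : ℝ} (hθ : θ ∈ Icc F.lo F.hi) :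
    F.cdf θ = ∫ s in F.lo..θ, F.f s := by
  rw [cdf, min_eq_left hθ.2, intervalIntegral.integral_of_le hθ.1, integral_Icc_eq_integral_Ioc]

lemma cdf_lo : F.cdf F.lo = 0 := by
  rw [F.cdf_eq_intervalIntegral (left_mem_Icc.2 F.lo_lt_hi.le), intervalIntegral.integral_same]

lemma cdf_hi : F.cdf F.hi = 1 := by
  rw [cdf, min_self, F.f_integral]

lemma hasDerivAt_cdf {θ : ℝ} (hθ : θ ∈ Ioo F.lo F.hi) : HasDerivAt F.cdf (F.f θ) θ := by
  have h1 : HasDerivAt (fun x => ∫ s in F.lo..x, F.f s) (F.f θ) θ := by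
    apply intervalIntegral.integral_hasDerivAt_right
    · apply ContinuousOn.intervalIntegrable
      rw [uIcc_of_le hθ.1.le]
      exact F.f_cont.mono (Icc_subset_Icc_right hθ.2.le)
    · exact (F.f_cont.mono Ioo_subset_Icc_self).stronglyMeasurableAtFilter isOpen_Ioo θ hθ
    · exact F.f_cont.continuousAt (Icc_mem_nhds hθ.1 hθ.2)
  refine h1.congr_of_eventuallyEq ?_
  filter_upwards [Icc_mem_nhds hθ.1 hθ.2] with x hx using F.cdf_eq_intervalIntegral hx

lemma continuousOn_cdf : ContinuousOn F.cdf (Icc F.lo F.hi) := by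
  have h1 : ContinuousOn (fun x => ∫ s in F.lo..x, F.f s) (Icc F.lo F.hi) := by
    have := intervalIntegral.continuousOn_primitive_interval (a := F.lo) (b := F.hi) (f := F.f)
      (μ := volume) (by rw [uIcc_of_le F.lo_lt_hi.le]; exact F.integrableOn_f)
    rwa [uIcc_of_le F.lo_lt_hi.le] at this
  exact h1.congr fun x hx => F.cdf_eq_intervalIntegral hx

lemma strictMonoOn_cdf : StrictMonoOn F.cdf (Icc F.lo F.hi) := by
  refine strictMonoOn_of_deriv_pos (convex_Icc _ _) F.continuousOn_cdf fun x hx => ?_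
  rw [interior_Icc] at hx
  rw [(F.hasDerivAt_cdf hx).deriv]
  exact F.f_pos x (Ioo_subset_Icc_self hx)

lemma quantile_cdf {θ : ℝ} (hθ : θ ∈ Icc F.lo F.hi) : F.quantile (F.cdf θ) = θ := by
  have : {x | x ∈ Icc F.lo F.hi ∧ F.cdf x ≤ F.cdf θ} = Icc F.lo θ := by
    ext x
    constructor
    · rintro ⟨hx, h⟩
      exact ⟨hx.1, (F.strictMonoOn_cdf.le_iff_le hx hθ).1 h⟩
    · intro hx
      have hx' : x ∈ Icc F.lo F.hi := ⟨hx.1, hx.2.trans hθ.2⟩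
      exact ⟨hx', (F.strictMonoOn_cdf.le_iff_le hx' hθ).2 hx.2⟩
  rw [quantile, this, csSup_Icc hθ.1]

lemma exists_cdf_eq {u : ℝ} (hu : u ∈ Icc (0 : ℝ) 1) :
    ∃ θ ∈ Icc F.lo F.hi, F.cdf θ = u := by
  have := intermediate_value_Icc F.lo_lt_hi.le F.continuousOn_cdf
  rw [F.cdf_lo, F.cdf_hi] at this
  exact this hu

lemma quantile_mem {u : ℝ} (hu : u ∈ Icc (0 : ℝ) 1) : F.quantile u ∈ Icc F.lo F.hi := by
  obtain ⟨θ, hθ, rfl⟩ := F.exists_cdf_eq hu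
  rwa [F.quantile_cdf hθ]

lemma cdf_quantile {u : ℝ} (hu : u ∈ Icc (0 : ℝ) 1) : F.cdf (F.quantile u) = u := by
  obtain ⟨θ, hθ, rfl⟩ := F.exists_cdf_eq hu
  rw [F.quantile_cdf hθ]

lemma quantile_one : F.quantile 1 = F.hi := by
  rw [← F.cdf_hi, F.quantile_cdf (right_mem_Icc.2 F.lo_lt_hi.le)]

lemma quantile_zero : F.quantile 0 = F.lo := by
  rw [← F.cdf_lo, F.quantile_cdf (left_mem_Icc.2 F.lo_lt_hi.le)]

lemma strictMonoOn_quantile : StrictMonoOn F.quantile (Icc 0 1) := by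
  intro u hu w hw h
  rwa [← F.strictMonoOn_cdf.lt_iff_lt (F.quantile_mem hu) (F.quantile_mem hw),
    F.cdf_quantile hu, F.cdf_quantile hw]

/-- Strict monotonicity of the CDF turns a comparison of a quantile with a level `b` in the support
into a comparison of `u` with `F.cdf b`; levels outside the support are trivial. -/
lemma continuousOn_quantile : ContinuousOn F.quantile (Icc 0 1) := by
  intro u hu
  refine tendsto_order.2 ⟨fun b hb => ?_, fun b hb => ?_⟩
  · by_cases hlo : b < F.lo
    · filter_upwards [self_mem_nhdsWithin] with w hw using hlo.trans_le (F.quantile_mem hw).1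
    · have hb' : b ∈ Icc F.lo F.hi := ⟨not_lt.1 hlo, hb.le.trans (F.quantile_mem hu).2⟩
      have h1 := F.strictMonoOn_cdf hb' (F.quantile_mem hu) hb
      rw [F.cdf_quantile hu] at h1
      filter_upwards [self_mem_nhdsWithin, mem_nhdsWithin_of_mem_nhds (Ioi_mem_nhds h1)] with w hw hw2
      rw [← F.strictMonoOn_cdf.lt_iff_lt hb' (F.quantile_mem hw), F.cdf_quantile hw]
      exact hw2
  · by_cases hhi : F.hi < b
    · filter_upwards [self_mem_nhdsWithin] with w hw using (F.quantile_mem hw).2.trans_lt hhi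
    · have hb' : b ∈ Icc F.lo F.hi := ⟨(F.quantile_mem hu).1.trans hb.le, not_lt.1 hhi⟩
      have h1 := F.strictMonoOn_cdf (F.quantile_mem hu) hb' hb
      rw [F.cdf_quantile hu] at h1
      filter_upwards [self_mem_nhdsWithin, mem_nhdsWithin_of_mem_nhds (Iio_mem_nhds h1)] with w hw hw2
      rw [← F.strictMonoOn_cdf.lt_iff_lt (F.quantile_mem hw) hb', F.cdf_quantile hw]
      exact hw2

lemma hasDerivAt_quantile {u : ℝ} (hu : u ∈ Ioo (0 : ℝ) 1) :
    HasDerivAt F.quantile (F.f (F.quantile u))⁻¹ u := by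
  have hu' := Ioo_subset_Icc_self hu
  have hq : F.quantile u ∈ Ioo F.lo F.hi := by
    rw [← F.quantile_zero, ← F.quantile_one]
    exact ⟨F.strictMonoOn_quantile (by simp) hu' hu.1, F.strictMonoOn_quantile hu' (by simp) hu.2⟩
  have hn := Icc_mem_nhds hu.1 hu.2
  refine HasDerivAt.of_local_left_inverse (F.continuousOn_quantile.continuousAt hn)
    (F.hasDerivAt_cdf hq) (F.f_pos _ (F.quantile_mem hu')).ne' ?_
  filter_upwards [hn] with w hw using F.cdf_quantile hw

/-- Myerson's virtual value in the quantile space. -/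
noncomputable def virtualValue (u : ℝ) : ℝ := F.mvv (F.quantile u)

lemma virtualValue_eq {u : ℝ} (hu : u ∈ Icc (0 : ℝ) 1) :
    F.virtualValue u = F.quantile u - (1 - u) / F.f (F.quantile u) := by
  rw [virtualValue, mvv, F.cdf_quantile hu]

lemma virtualValue_one : F.virtualValue 1 = F.hi := by
  rw [F.virtualValue_eq (by simp), F.quantile_one]
  simp

lemma continuousOn_virtualValue : ContinuousOn F.virtualValue (Icc 0 1) := by
  refine ContinuousOn.congr ?_ fun u hu => F.virtualValue_eq hu
  refine F.continuousOn_quantile.sub (ContinuousOn.div (by fun_prop)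
    (F.f_cont.comp F.continuousOn_quantile fun u hu => F.quantile_mem hu) fun u hu => ?_)
  exact (F.f_pos _ (F.quantile_mem hu)).ne'

variable {F}

lemma strictMonoOn_virtualValue (hF : StrictMonoOn F.mvv (Icc F.lo F.hi)) :
    StrictMonoOn F.virtualValue (Icc 0 1) :=
  hF.comp F.strictMonoOn_quantile fun _ hu => F.quantile_mem hu

/-- Between distributions with a common highest type, the star order orders the nonnegative
virtual values of each quantile. -/
lemma StarGe.virtualValue_le {G : TypeDist} (hFG : F.StarGe G) (hhi : F.hi = G.hi) {u : ℝ}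
    (hu : u ∈ Ioc (0 : ℝ) 1) (hv : 0 ≤ F.virtualValue u) :
    F.virtualValue u ≤ G.virtualValue u := by
  rcases hu.2.eq_or_lt with rfl | hu1
  · rw [F.virtualValue_one, G.virtualValue_one, hhi]
  have huo : u ∈ Ioo (0 : ℝ) 1 := ⟨hu.1, hu1⟩
  have hui := Ioo_subset_Icc_self huo
  have hGhi : 0 < G.hi := G.lo_nonneg.trans_lt G.lo_lt_hi
  have hFq : 0 < F.quantile u := by
    refine F.lo_nonneg.trans_lt ?_
    rw [← F.quantile_zero]
    exact F.strictMonoOn_quantile (by simp) hui hu.1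
  -- The star order between `u` and `1`, after cancelling the common highest type.
  have hq : F.quantile u ≤ G.quantile u := by
    have := hFG u hui 1 (by simp) hu.2
    rw [F.quantile_one, G.quantile_one, hhi, mul_comm] at this
    exact le_of_mul_le_mul_left this hGhi
  -- The difference of cross products in the star order vanishes at `w = u` and is nonnegative for
  -- `w > u`, so its derivative at `u` is nonnegative.
  have hderiv : F.quantile u * (G.f (G.quantile u))⁻¹ ≤ (F.f (F.quantile u))⁻¹ * G.quantile u := by
    have h1 : HasDerivAt (fun w => F.quantile w * G.quantile u - F.quantile u * G.quantile w)
        ((F.f (F.quantile u))⁻¹ * G.quantile u - F.quantile u * (G.f (G.quantile u))⁻¹) u :=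
      ((F.hasDerivAt_quantile huo).mul_const _).sub ((G.hasDerivAt_quantile huo).const_mul _)
    have h2 := (hasDerivWithinAt_iff_tendsto_slope' (s := Ioi u) (by simp)).1
      h1.hasDerivWithinAt
    refine sub_nonneg.1 (ge_of_tendsto h2 ?_)
    filter_upwards [Ioo_mem_nhdsGT hu1] with w hw
    rw [slope_def_field]
    refine div_nonneg ?_ (sub_nonneg.2 hw.1.le)
    have := hFG u hui w ⟨hu.1.le.trans hw.1.le, hw.2.le⟩ hw.1.le
    linarith
  rw [F.virtualValue_eq hui] at hv ⊢
  rw [G.virtualValue_eq hui]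
  rw [div_eq_mul_inv] at hv ⊢
  rw [div_eq_mul_inv]
  set a := (F.f (F.quantile u))⁻¹
  set b := (G.f (G.quantile u))⁻¹
  -- After scaling by the positive quantile of `F`, `hderiv` bounds the right side below by
  -- `G.quantile u` times the virtual value of `F`; `hq` and `hv` finish.
  have h3 : F.quantile u * (F.quantile u - (1 - u) * a)
      ≤ F.quantile u * (G.quantile u - (1 - u) * b) := by
    have h4 := mul_le_mul_of_nonneg_left hderiv (sub_nonneg.2 hu.2)
    have h5 := mul_le_mul_of_nonneg_right hq hv
    nlinarith
  exact le_of_mul_le_mul_left h3 hFq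

end TypeDist

/-! ### Logarithmic coordinates and crossing paths -/

/-- Exponential substitution on the unit interval. -/
lemma setIntegral_Ioo_zero_one_eq (g : ℝ → ℝ) :
    ∫ u in Ioo (0 : ℝ) 1, g u = ∫ s in Ioi (0 : ℝ), Real.exp (-s) * g (Real.exp (-s)) := by
  have himg : (fun s : ℝ => Real.exp (-s)) '' Ioi 0 = Ioo 0 1 := by
    ext u
    constructor
    · rintro ⟨s, hs, rfl⟩
      exact ⟨Real.exp_pos _, Real.exp_lt_one_iff.2 (neg_lt_zero.2 hs)⟩
    · intro hu
      exact ⟨-Real.log u, neg_pos.2 (Real.log_neg hu.1 hu.2), by simp [Real.exp_log hu.1]⟩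
  have h := integral_image_eq_integral_abs_deriv_smul (s := Ioi (0 : ℝ))
    (f := fun s : ℝ => Real.exp (-s)) (f' := fun s => -Real.exp (-s)) measurableSet_Ioi
    (fun x _ => by simpa using ((hasDerivAt_neg x).exp).hasDerivWithinAt)
    (fun a _ b _ hab => by simpa using hab) g
  rw [himg] at h
  rw [h]
  simp [abs_of_pos, Real.exp_pos]

/-- Integration over the unit square along the hyperbolas `y * u = e^(-t)`. -/
lemma integral_square_eq_integral_hyperbolas {G : ℝ → ℝ → ℝ}
    (hG : Measurable (Function.uncurry G)) {C : ℝ} (hC : ∀ y u, |G y u| ≤ C) :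
    ∫ u in Ioo (0 : ℝ) 1, ∫ y in Ioo (0 : ℝ) 1, G y u
      = ∫ t in Ioi (0 : ℝ), Real.exp (-t) *
          ∫ τ in Ioo (0 : ℝ) t, G (Real.exp (τ - t)) (Real.exp (-τ)) := by
  set K : ℝ → ℝ → ℝ := fun τ t => if 0 < τ ∧ τ < t then
    Real.exp (-t) * G (Real.exp (τ - t)) (Real.exp (-τ)) else 0 with hK
  have hmeas : Measurable (Function.uncurry K) := by
    refine Measurable.ite ?_ ?_ measurable_const
    · exact (measurableSet_lt measurable_const measurable_fst).inter
        (measurableSet_lt measurable_fst measurable_snd)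
    · refine Measurable.mul (by fun_prop) ?_
      exact hG.comp (f := fun z : ℝ × ℝ => (Real.exp (z.1 - z.2), Real.exp (-z.1))) (by fun_prop)
  have hint : Integrable (Function.uncurry K) (volume.prod volume) := by
    rw [← integrable_swap_iff, integrable_prod_iff
      (hmeas.comp measurable_swap).aestronglyMeasurable]
    have hle : ∀ t τ, ‖K τ t‖ ≤ (Ioo 0 t).indicator (fun _ => C * Real.exp (-t)) τ := by
      intro t τ
      simp only [hK]
      by_cases h : 0 < τ ∧ τ < t
      · rw [if_pos h, indicator_of_mem (show τ ∈ Ioo 0 t from h), norm_mul, Real.norm_eq_abs,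
          Real.norm_eq_abs, abs_of_pos (Real.exp_pos _), mul_comm]
        exact mul_le_mul_of_nonneg_right (hC _ _) (Real.exp_pos _).le
      · rw [if_neg h, indicator_of_notMem (show τ ∉ Ioo 0 t from h), norm_zero]
    have hind : ∀ t : ℝ, Integrable ((Ioo 0 t).indicator (fun _ : ℝ => C * Real.exp (-t))) := by
      intro t
      rw [integrable_indicator_iff measurableSet_Ioo]
      exact integrableOn_const (by simp)
    constructor
    · refine Filter.Eventually.of_forall fun t => ?_
      exact (hind t).mono' (hmeas.comp (measurable_id.prodMk measurable_const)).aestronglyMeasurable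
        (Filter.Eventually.of_forall (hle t))
    · have h1 : Integrable ((Ioi (0 : ℝ)).indicator fun t => C * (t * Real.exp (-t))) := by
        rw [integrable_indicator_iff measurableSet_Ioi]
        have := (Real.GammaIntegral_convergent (s := 2) (by norm_num))
        refine (Integrable.const_mul ?_ C)
        refine IntegrableOn.congr_fun this (fun t ht => ?_) measurableSet_Ioi
        norm_num
        ring
      refine h1.mono' ?_ (Filter.Eventually.of_forall fun t => ?_)
      · exact ((hmeas.comp measurable_swap).norm.stronglyMeasurable.integral_prod_right
          (ν := volume)).aestronglyMeasurable
      · rw [Real.norm_of_nonneg (integral_nonneg fun _ => norm_nonneg _)]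
        refine (integral_mono_of_nonneg (Filter.Eventually.of_forall fun _ => norm_nonneg _)
          (hind t) (Filter.Eventually.of_forall (hle t))).trans ?_
        rw [integral_indicator measurableSet_Ioo, setIntegral_const]
        by_cases ht : 0 < t
        · rw [indicator_of_mem (show t ∈ Ioi 0 from ht)]
          simp [ht.le]
          linarith
        · rw [indicator_of_notMem (show t ∉ Ioi 0 from ht)]
          simp [not_lt.1 ht]
  have hswap := integral_integral_swap hint
  have hl : ∫ τ, ∫ t, K τ t = ∫ u in Ioo (0 : ℝ) 1, ∫ y in Ioo (0 : ℝ) 1, G y u := by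
    rw [setIntegral_Ioo_zero_one_eq, ← integral_indicator measurableSet_Ioi]
    refine integral_congr_ae (Filter.Eventually.of_forall fun τ => ?_)
    by_cases hτ : 0 < τ
    · simp only []
      rw [indicator_of_mem (show τ ∈ Ioi 0 from hτ), setIntegral_Ioo_zero_one_eq,
        ← integral_const_mul, ← integral_indicator measurableSet_Ioi]
      -- With `y = e^(-s)`, shift to `s = t - τ`; the two Jacobians then multiply to `e^(-t)`.
      conv_rhs => rw [← integral_sub_right_eq_self _ τ]
      refine integral_congr_ae (Filter.Eventually.of_forall fun t => ?_)
      simp only [hK, indicator, mem_Ioi, sub_pos, hτ, true_and]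
      split_ifs
      · rw [← mul_assoc, ← Real.exp_add]
        ring_nf
      · rfl
    · rw [indicator_of_notMem (show τ ∉ Ioi 0 from hτ)]
      simp [hK, hτ]
  have hr : ∫ t, ∫ τ, K τ t = ∫ t in Ioi (0 : ℝ), Real.exp (-t) *
      ∫ τ in Ioo (0 : ℝ) t, G (Real.exp (τ - t)) (Real.exp (-τ)) := by
    rw [← integral_indicator measurableSet_Ioi]
    refine integral_congr_ae (Filter.Eventually.of_forall fun t => ?_)
    by_cases ht : 0 < t
    · simp only []
      rw [indicator_of_mem (show t ∈ Ioi 0 from ht), ← integral_const_mul,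
        ← integral_indicator measurableSet_Ioo]
      refine integral_congr_ae (Filter.Eventually.of_forall fun τ => ?_)
      simp only [hK, indicator, mem_Ioo]
    · rw [indicator_of_notMem (show t ∉ Ioi 0 from ht)]
      have : ∀ τ, ¬ (0 < τ ∧ τ < t) := fun τ h => ht (h.1.trans h.2)
      simp [hK, this]
  rw [← hl, ← hr, hswap]

/-- The point at which the hyperbola `y * u = e^(-t)` leaves the region below the graph of `x`,
in logarithmic coordinates. -/
def crossing (x : ℝ → ℝ) (t : ℝ) : ℝ :=
  sSup {τ | τ ∈ Icc 0 t ∧ Real.exp (τ - t) ≤ x (Real.exp (-τ))}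

lemma exp_neg_mem {s : ℝ} (hs : 0 ≤ s) : Real.exp (-s) ∈ Icc (0 : ℝ) 1 :=
  ⟨(Real.exp_pos _).le, Real.exp_le_one_iff.2 (neg_nonpos.2 hs)⟩

lemma exp_sub_mem {s t : ℝ} (hs : s ≤ t) : Real.exp (s - t) ∈ Icc (0 : ℝ) 1 :=
  ⟨(Real.exp_pos _).le, Real.exp_le_one_iff.2 (sub_nonpos.2 hs)⟩

variable {x : ℝ → ℝ}

lemma crossing_bddAbove (t : ℝ) :
    BddAbove {τ | τ ∈ Icc 0 t ∧ Real.exp (τ - t) ≤ x (Real.exp (-τ))} :=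
  ⟨t, fun _ h => h.1.2⟩

/-- The Fubini argument wants globally measurable, bounded functions, while virtual values and `h'`
are controlled only on `[0, 1]`. -/
lemma exists_continuous_extension {g : ℝ → ℝ} (hg : ContinuousOn g (Icc 0 1)) :
    ∃ g' : ℝ → ℝ, Continuous g' ∧ (∃ C, ∀ u, |g' u| ≤ C) ∧ ∀ u ∈ Icc (0 : ℝ) 1, g' u = g u := by
  refine ⟨IccExtend zero_le_one ((Icc (0 : ℝ) 1).domRestrict g), ?_, ?_, fun u hu => ?_⟩
  · exact (continuousOn_iff_continuous_domRestrict.1 hg).Icc_extend'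
  · obtain ⟨C, hC⟩ := isCompact_Icc.exists_bound_of_continuousOn hg
    exact ⟨C, fun u => hC _ (projIcc (0 : ℝ) 1 zero_le_one u).2⟩
  · rw [IccExtend_of_mem _ _ hu, domRestrict_apply]

namespace IsCDF

lemma zero_mem_crossing (hx : IsCDF x) {t : ℝ} (ht : 0 ≤ t) :
    0 ∈ {τ | τ ∈ Icc 0 t ∧ Real.exp (τ - t) ≤ x (Real.exp (-τ))} := by
  refine ⟨left_mem_Icc.2 ht, ?_⟩
  rw [neg_zero, Real.exp_zero, hx.2.2.2]
  exact (exp_sub_mem ht).2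

lemma crossing_nonneg (hx : IsCDF x) {t : ℝ} (ht : 0 ≤ t) : 0 ≤ crossing x t :=
  le_csSup (crossing_bddAbove t) (hx.zero_mem_crossing ht)

lemma crossing_le (hx : IsCDF x) {t : ℝ} (ht : 0 ≤ t) : crossing x t ≤ t :=
  csSup_le ⟨0, hx.zero_mem_crossing ht⟩ fun _ h => h.1.2

lemma crossing_mem (hx : IsCDF x) {t : ℝ} (ht : 0 ≤ t) : crossing x t ∈ Icc 0 t :=
  ⟨hx.crossing_nonneg ht, hx.crossing_le ht⟩

/-- As `τ` falls, `e^(τ-t)` falls and `x (e^(-τ))` rises, so the defining set is downward closed in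
`[0, t]`. The strict inequality avoids asking whether the supremum is attained. -/
lemma le_of_lt_crossing (hx : IsCDF x) {t τ : ℝ} (hτ : 0 ≤ τ) (h : τ < crossing x t)
    (ht : 0 ≤ t) : Real.exp (τ - t) ≤ x (Real.exp (-τ)) := by
  obtain ⟨σ, hσ, hlt⟩ := exists_lt_of_lt_csSup ⟨0, hx.zero_mem_crossing ht⟩ h
  refine (Real.exp_le_exp.2 (by linarith)).trans (hσ.2.trans ?_)
  exact hx.1 (exp_neg_mem hσ.1.1) (exp_neg_mem hτ) (Real.exp_le_exp.2 (by linarith))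

lemma monotoneOn_crossing (hx : IsCDF x) : MonotoneOn (crossing x) (Ici 0) := by
  intro s hs t _ hst
  refine csSup_le_csSup (crossing_bddAbove t) ⟨0, hx.zero_mem_crossing hs⟩ ?_
  rintro τ ⟨hτ, h⟩
  exact ⟨⟨hτ.1, hτ.2.trans hst⟩, (Real.exp_le_exp.2 (by linarith)).trans h⟩

lemma mem_Icc (hx : IsCDF x) {u : ℝ} (hu : u ∈ Icc (0 : ℝ) 1) : x u ∈ Icc (0 : ℝ) 1 :=
  ⟨hx.2.2.1.trans (hx.1 (by simp) hu hu.1), (hx.1 hu (by simp) hu.2).trans hx.2.2.2.le⟩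

/-- The integral of a product density below the graph of a distribution function, in
logarithmic coordinates. -/
lemma integral_subgraph_of_bounded (hx : IsCDF x) {v k : ℝ → ℝ} (hv : Measurable v)
    (hk : Measurable k) {Cv Ck : ℝ} (hCv : ∀ u, |v u| ≤ Cv) (hCk : ∀ y, |k y| ≤ Ck) :
    ∫ u in (0 : ℝ)..1, v u * ∫ y in (0 : ℝ)..x u, k y
      = ∫ t in Ioi (0 : ℝ), Real.exp (-t) *
          ∫ τ in (0 : ℝ)..crossing x t, v (Real.exp (-τ)) * k (Real.exp (τ - t)) := by
  -- Clamping the argument makes the function monotone on the whole line, hence measurable.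
  set X : ℝ → ℝ := fun u => x (projIcc (0 : ℝ) 1 zero_le_one u) with hX
  have hXm : Measurable X := by
    refine Monotone.measurable fun a b hab => ?_
    exact hx.1 (projIcc (0 : ℝ) 1 zero_le_one a).2 (projIcc (0 : ℝ) 1 zero_le_one b).2
      (monotone_projIcc _ hab)
  have hXe : ∀ u ∈ Icc (0 : ℝ) 1, X u = x u := fun u hu => by
    simp only [hX, projIcc_of_mem zero_le_one hu]
  set G : ℝ → ℝ → ℝ := fun y u => if y ≤ X u then v u * k y else 0 with hG
  have hGm : Measurable (Function.uncurry G) := by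
    refine Measurable.ite (measurableSet_le measurable_fst (hXm.comp measurable_snd)) ?_
      measurable_const
    exact (hv.comp measurable_snd).mul (hk.comp measurable_fst)
  have hCv0 : 0 ≤ Cv := (abs_nonneg _).trans (hCv 0)
  have hCk0 : 0 ≤ Ck := (abs_nonneg _).trans (hCk 0)
  have hGC : ∀ y u, |G y u| ≤ Cv * Ck := by
    intro y u
    simp only [hG]
    split_ifs
    · rw [abs_mul]
      exact mul_le_mul (hCv u) (hCk y) (abs_nonneg _) hCv0
    · simpa using mul_nonneg hCv0 hCk0
  have h := integral_square_eq_integral_hyperbolas hGm hGC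
  have hl : ∫ u in Ioo (0 : ℝ) 1, ∫ y in Ioo (0 : ℝ) 1, G y u
      = ∫ u in (0 : ℝ)..1, v u * ∫ y in (0 : ℝ)..x u, k y := by
    rw [intervalIntegral.integral_of_le zero_le_one, integral_Ioc_eq_integral_Ioo]
    refine setIntegral_congr_fun measurableSet_Ioo fun u hu => ?_
    have hu' := Ioo_subset_Icc_self hu
    have hxu := hx.mem_Icc hu'
    rw [← intervalIntegral.integral_const_mul, intervalIntegral.integral_of_le hxu.1,
      ← integral_Ioc_eq_integral_Ioo, ← integral_indicator measurableSet_Ioc,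
      ← integral_indicator measurableSet_Ioc]
    congr 1
    ext y
    simp only [hG, indicator, hXe u hu', mem_Ioc]
    by_cases h1 : y ≤ x u
    · have : y ≤ 1 := h1.trans hxu.2
      simp [h1, this]
    · simp [h1]
  have hr : ∀ t ∈ Ioi (0 : ℝ), ∫ τ in Ioo (0 : ℝ) t, G (Real.exp (τ - t)) (Real.exp (-τ))
      = ∫ τ in (0 : ℝ)..crossing x t, v (Real.exp (-τ)) * k (Real.exp (τ - t)) := by
    intro t ht
    have hc := hx.crossing_mem (le_of_lt ht)
    rw [intervalIntegral.integral_of_le hc.1, ← integral_indicator measurableSet_Ioo,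
      ← integral_indicator measurableSet_Ioc]
    refine integral_congr_ae ?_
    filter_upwards [Measure.ae_ne volume (crossing x t)
      , Measure.ae_ne volume t] with τ hτ hτt
    by_cases h0 : 0 < τ
    · simp only [indicator, mem_Ioo, mem_Ioc, h0, true_and, hG,
        hXe _ (exp_neg_mem h0.le)]
      rcases lt_or_gt_of_ne hτ with h1 | h1
      · rw [if_pos (h1.trans_le hc.2), if_pos h1.le,
          if_pos (hx.le_of_lt_crossing h0.le h1 (le_of_lt ht))]
      · rw [if_neg (not_le.2 h1)]
        by_cases h2 : τ < t
        · rw [if_pos h2, if_neg]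
          intro h3
          exact (not_le.2 h1) (le_csSup (crossing_bddAbove t) ⟨⟨h0.le, h2.le⟩, h3⟩)
        · rw [if_neg h2]
    · simp [indicator, h0]
  rw [← hl, h]
  exact setIntegral_congr_fun measurableSet_Ioi fun t ht => by simp only [hr t ht]

/-- `integral_subgraph_of_bounded` for continuous densities. -/
lemma integral_subgraph (hx : IsCDF x) {v k : ℝ → ℝ} (hv : ContinuousOn v (Icc 0 1))
    (hk : ContinuousOn k (Icc 0 1)) :
    ∫ u in (0 : ℝ)..1, v u * ∫ y in (0 : ℝ)..x u, k y
      = ∫ t in Ioi (0 : ℝ), Real.exp (-t) *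
          ∫ τ in (0 : ℝ)..crossing x t, v (Real.exp (-τ)) * k (Real.exp (τ - t)) := by
  obtain ⟨v', hv'c, ⟨Cv, hCv⟩, hv'⟩ := exists_continuous_extension hv
  obtain ⟨k', hk'c, ⟨Ck, hCk⟩, hk'⟩ := exists_continuous_extension hk
  have h := hx.integral_subgraph_of_bounded hv'c.measurable hk'c.measurable hCv hCk
  refine Eq.trans ?_ (h.trans ?_)
  · refine intervalIntegral.integral_congr fun u hu => ?_
    rw [uIcc_of_le zero_le_one] at hu
    simp only [hv' u hu]
    congr 1
    refine intervalIntegral.integral_congr fun y hy => ?_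
    rw [uIcc_of_le (hx.mem_Icc hu).1] at hy
    exact (hk' y ⟨hy.1, hy.2.trans (hx.mem_Icc hu).2⟩).symm
  · refine setIntegral_congr_fun measurableSet_Ioi fun t ht => ?_
    congr 1
    have hc := hx.crossing_mem (le_of_lt ht)
    refine intervalIntegral.integral_congr fun τ hτ => ?_
    rw [uIcc_of_le hc.1] at hτ
    simp only [hv' _ (exp_neg_mem hτ.1), hk' _ (exp_sub_mem (hτ.2.trans hc.2))]

/-- The cutoff `u > e^(-a)` means `τ < a`, so it truncates the crossing path at `a`. This expresses
each term of the Border constraints through paths. -/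
lemma integral_Ioc_one (hx : IsCDF x) {a : ℝ} (ha : 0 ≤ a) :
    ∫ s in Real.exp (-a)..1, x s
      = ∫ t in Ioi (0 : ℝ), Real.exp (-t) * min (crossing x t) a := by
  have h := hx.integral_subgraph_of_bounded (v := (Ioc (Real.exp (-a)) 1).indicator 1)
    (k := fun _ => 1) (measurable_one.indicator measurableSet_Ioc) measurable_const
    (Cv := 1) (Ck := 1) (fun u => by
      simp only [indicator, Pi.one_apply]; split_ifs <;> simp) (fun y => by simp)
  refine Eq.trans ?_ (h.trans ?_)
  · rw [intervalIntegral.integral_of_le (exp_neg_mem ha).2,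
      intervalIntegral.integral_of_le zero_le_one, ← integral_indicator measurableSet_Ioc,
      ← integral_indicator measurableSet_Ioc]
    congr 1
    ext u
    have := Real.exp_pos (-a)
    simp only [indicator, mem_Ioc, intervalIntegral.integral_const, sub_zero, smul_eq_mul, mul_one,
      Pi.one_apply]
    by_cases h1 : Real.exp (-a) < u ∧ u ≤ 1
    · simp [h1, this.trans h1.1]
    · simp [h1]
  · refine setIntegral_congr_fun measurableSet_Ioi fun t ht => ?_
    simp only [mul_one]
    congr 1
    have hc := hx.crossing_mem (le_of_lt ht)
    rw [intervalIntegral.integral_of_le hc.1]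
    have hm : 0 ≤ min (crossing x t) a := le_min hc.1 ha
    have : min (crossing x t) a = ∫ τ in Ioo (0 : ℝ) (min (crossing x t) a), (1 : ℝ) := by
      simp [hm]
    rw [this, ← integral_indicator measurableSet_Ioc, ← integral_indicator measurableSet_Ioo]
    refine integral_congr_ae ?_
    filter_upwards [Measure.ae_ne volume (crossing x t)]
      with τ hτ
    simp only [indicator, mem_Ioc, mem_Ioo, Pi.one_apply, lt_min_iff, Real.exp_lt_exp, neg_lt_neg_iff]
    by_cases h0 : 0 < τ
    · have h1 : Real.exp (-τ) ≤ 1 := (exp_neg_mem h0.le).2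
      have h2 : τ ≤ crossing x t ↔ τ < crossing x t := ⟨fun h => lt_of_le_of_ne h hτ, le_of_lt⟩
      simp only [h0, h1, h2, true_and, and_true, ite_and]
    · simp [h0]

lemma integral_zero_one (hx : IsCDF x) :
    ∫ s in (0 : ℝ)..1, x s = ∫ t in Ioi (0 : ℝ), Real.exp (-t) * crossing x t := by
  have h := hx.integral_subgraph (v := fun _ => 1) (k := fun _ => 1) continuousOn_const
    continuousOn_const
  simpa using h

end IsCDF

/-! ### Paths and the distribution functions they determine -/

/-- A path `δ` in logarithmic coordinates along which both `δ` and the complement `t - δ t` are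
nondecreasing: the crossing path of a distribution function with closed subgraph. -/
structure IsPath (δ : ℝ → ℝ) : Prop where
  mem : ∀ t, 0 ≤ t → δ t ∈ Icc 0 t
  mono : MonotoneOn δ (Ici 0)
  mono_sub : MonotoneOn (fun t => t - δ t) (Ici 0)

namespace IsPath

variable {δ : ℝ → ℝ}

lemma zero (hδ : IsPath δ) : δ 0 = 0 := le_antisymm (hδ.mem 0 le_rfl).2 (hδ.mem 0 le_rfl).1

/-- Monotonicity of both `δ` and its complement makes `δ` 1-Lipschitz. -/
lemma continuousOn (hδ : IsPath δ) : ContinuousOn δ (Ici 0) := by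
  refine LipschitzOnWith.continuousOn (K := 1) (LipschitzOnWith.of_le_add fun s hs t ht => ?_)
  rcases le_total s t with h | h
  · have := hδ.mono hs ht h
    have := dist_nonneg (x := s) (y := t)
    linarith
  · have := hδ.mono_sub ht hs h
    simp only at this
    rw [Real.dist_eq, abs_of_nonneg (sub_nonneg.2 h)]
    linarith

/-- The largest winning probability at quantile `e^(-a)` below the path. -/
def height (δ : ℝ → ℝ) (a : ℝ) : ℝ :=
  open Classical in
  if (∃ t, a ≤ t ∧ a ≤ δ t) then Real.exp (a - sInf {t | a ≤ t ∧ a ≤ δ t}) else 0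

lemma height_nonneg (δ : ℝ → ℝ) (a : ℝ) : 0 ≤ height δ a := by
  unfold height
  split_ifs
  · exact (Real.exp_pos _).le
  · exact le_rfl

lemma height_le_one (δ : ℝ → ℝ) (a : ℝ) : height δ a ≤ 1 := by
  unfold height
  split_ifs with h
  · refine Real.exp_le_one_iff.2 (sub_nonpos.2 ?_)
    exact le_csInf h fun _ ht => ht.1
  · exact zero_le_one

/-- Continuity of `δ` makes the set of times at which it has reached `a` closed, so the infimum is
attained, and monotonicity makes it a threshold. -/
lemma exp_le_height_iff (hδ : IsPath δ) {a b : ℝ} (ha : 0 ≤ a) (hb : 0 ≤ b) :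
    Real.exp (-b) ≤ height δ a ↔ a ≤ δ (a + b) := by
  unfold height
  have hbdd : BddBelow {t | a ≤ t ∧ a ≤ δ t} := ⟨a, fun _ ht => ht.1⟩
  split_ifs with h
  · have hcl : IsClosed {t | a ≤ t ∧ a ≤ δ t} := by
      have h1 : ContinuousOn δ (Ici a) := hδ.continuousOn.mono (Ici_subset_Ici.2 ha)
      exact h1.preimage_isClosed_of_isClosed isClosed_Ici (isClosed_Ici (a := a))
    have hmem := hcl.csInf_mem h hbdd
    rw [Real.exp_le_exp]
    constructor
    · intro hle
      refine hmem.2.trans (hδ.mono (ha.trans hmem.1) (add_nonneg ha hb) ?_)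
      linarith
    · intro hle
      have := csInf_le hbdd (show a + b ∈ {t | a ≤ t ∧ a ≤ δ t} from ⟨by linarith, hle⟩)
      linarith
  · constructor
    · intro hle
      exact absurd hle (not_le.2 (Real.exp_pos _))
    · intro hle
      exact absurd ⟨a + b, by linarith, hle⟩ h

/-- Going back in time by `b - a` lowers `δ` by at most `b - a`, so a path that reaches `b` at time
`b + c` has reached `a` by time `a + c`. -/
lemma height_anti (hδ : IsPath δ) : AntitoneOn (height δ) (Ici 0) := by
  intro a ha b hb hab
  rcases (height_nonneg δ b).eq_or_lt with h0 | h0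
  · rw [← h0]
    exact height_nonneg δ a
  · have hc : 0 ≤ -Real.log (height δ b) :=
      neg_nonneg.2 (Real.log_nonpos h0.le (height_le_one δ b))
    have h1 : Real.exp (-(-Real.log (height δ b))) = height δ b := by
      rw [neg_neg, Real.exp_log h0]
    have h2 := (hδ.exp_le_height_iff hb hc).1 h1.le
    rw [← h1]
    refine (hδ.exp_le_height_iff ha hc).2 ?_
    have h3 := hδ.mono_sub (show a + -Real.log (height δ b) ∈ Ici (0 : ℝ) from add_nonneg ha hc)
      (show b + -Real.log (height δ b) ∈ Ici (0 : ℝ) from add_nonneg hb hc) (by linarith)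
    simp only at h3
    linarith

lemma height_zero (hδ : IsPath δ) : height δ 0 = 1 := by
  refine le_antisymm (height_le_one δ 0) ?_
  have := (hδ.exp_le_height_iff le_rfl le_rfl).2 (by rw [add_zero, hδ.zero])
  simpa using this

/-- Every path is the crossing path of a distribution function. -/
theorem exists_isCDF (hδ : IsPath δ) :
    ∃ x : ℝ → ℝ, IsCDF x ∧ (∀ t, 0 ≤ t → crossing x t = δ t) ∧
      ∀ a b, 0 ≤ a → 0 ≤ b → (Real.exp (-b) ≤ x (Real.exp (-a)) ↔ a ≤ δ (a + b)) := by
  -- The value at `0` must be set by hand as the right limit: `Real.log 0 = 0` would give `height δ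
  -- 0 = 1`.
  set x : ℝ → ℝ := fun u => if u ≤ 0 then sInf ((fun w => height δ (-Real.log w)) '' Ioc 0 1)
    else height δ (-Real.log u) with hx
  have hpos : ∀ u, 0 < u → x u = height δ (-Real.log u) := fun u hu => by
    simp only [hx, if_neg (not_le.2 hu)]
  have h0 : x 0 = sInf ((fun w => height δ (-Real.log w)) '' Ioc 0 1) := by simp [hx]
  have hbdd : BddBelow ((fun w => height δ (-Real.log w)) '' Ioc 0 1) :=
    ⟨0, by rintro _ ⟨w, _, rfl⟩; exact height_nonneg _ _⟩
  have hne : ((fun w => height δ (-Real.log w)) '' Ioc (0 : ℝ) 1).Nonempty :=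
    ⟨_, 1, by simp, rfl⟩
  have hlog : ∀ u ∈ Icc (0 : ℝ) 1, 0 ≤ -Real.log u := fun u hu =>
    neg_nonneg.2 (Real.log_nonpos hu.1 hu.2)
  have hmono : MonotoneOn x (Icc 0 1) := by
    intro u hu w hw huw
    rcases hu.1.eq_or_lt with rfl | hu0
    · rcases hw.1.eq_or_lt with rfl | hw0
      · exact le_rfl
      · rw [h0, hpos w hw0]
        exact csInf_le hbdd ⟨w, ⟨hw0, hw.2⟩, rfl⟩
    · rw [hpos u hu0, hpos w (hu0.trans_le huw)]
      exact hδ.height_anti (hlog w hw) (hlog u hu)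
        (neg_le_neg (Real.log_le_log hu0 huw))
  have hle1 : ∀ u, 0 < u → x u ≤ 1 := fun u hu => by
    rw [hpos u hu]
    exact height_le_one _ _
  have hiff : ∀ a b, 0 ≤ a → 0 ≤ b →
      (Real.exp (-b) ≤ x (Real.exp (-a)) ↔ a ≤ δ (a + b)) := fun a b ha hb => by
    rw [hpos _ (Real.exp_pos _), Real.log_exp, neg_neg, hδ.exp_le_height_iff ha hb]
  refine ⟨x, ⟨hmono, ?_, ?_, ?_⟩, ?_, hiff⟩
  · intro u hu
    have hI : ∀ᶠ w in 𝓝[≥] u, w ∈ Ico u 1 := Ico_mem_nhdsGE hu.2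
    refine tendsto_order.2 ⟨fun l hl => ?_, fun y hy => ?_⟩
    · filter_upwards [hI] with w hw
      exact hl.trans_le (hmono ⟨hu.1, hu.2.le⟩ ⟨hu.1.trans hw.1, hw.2.le⟩ hw.1)
    · rcases hu.1.eq_or_lt with rfl | hu0
      · rw [h0] at hy
        obtain ⟨_, ⟨w, hw, rfl⟩, hwy⟩ := exists_lt_of_csInf_lt hne hy
        simp only at hwy
        rw [← hpos w hw.1] at hwy
        filter_upwards [hI, Ico_mem_nhdsGE hw.1] with s hs hs'
        exact (hmono ⟨hs.1, hs.2.le⟩ ⟨hw.1.le, hw.2⟩ hs'.2.le).trans_lt hwy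
      · rcases lt_or_ge 1 y with hy1 | hy1
        · filter_upwards [hI] with w hw using (hle1 w (hu0.trans_le hw.1)).trans_lt hy1
        · have hy0 : 0 < y := by
            refine lt_of_le_of_lt ?_ hy
            rw [hpos u hu0]
            exact height_nonneg _ _
          have hb : 0 ≤ -Real.log y := hlog y ⟨hy0.le, hy1⟩
          have ha : 0 ≤ -Real.log u := hlog u ⟨hu.1, hu.2.le⟩
          have key : ∀ w, 0 < w → w ≤ 1 →
              (x w < y ↔ δ (-Real.log w + -Real.log y) < -Real.log w) := by
            intro w hw hw1
            have := hiff (-Real.log w) (-Real.log y) (hlog w ⟨hw.le, hw1⟩) hb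
            rw [neg_neg, neg_neg, Real.exp_log hw, Real.exp_log hy0] at this
            rw [← not_le, ← not_le, this]
          have hlt := (key u hu0 hu.2.le).1 hy
          have hcl : ContinuousWithinAt (fun w => -Real.log w) (Ico u 1) u :=
            (Real.continuousAt_log hu0.ne').neg.continuousWithinAt
          have hcd : ContinuousWithinAt (fun w => δ (-Real.log w + -Real.log y)) (Ico u 1) u := by
            refine ContinuousWithinAt.comp (g := δ) (f := fun w => -Real.log w + -Real.log y)
              (t := Ici 0) (hδ.continuousOn _ (add_nonneg ha hb))
              (hcl.add continuousWithinAt_const) ?_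
            intro w hw
            exact add_nonneg (hlog w ⟨hu.1.trans hw.1, hw.2.le⟩) hb
          have hev := hcd.eventually_lt hcl hlt
          rw [nhdsWithin_Ico_eq_nhdsGE hu.2] at hev
          filter_upwards [hI, hev] with w hw hw2
          exact (key w (hu0.trans_le hw.1) hw.2.le).2 hw2
  · rw [h0]
    exact le_csInf hne (by rintro _ ⟨w, _, rfl⟩; exact height_nonneg _ _)
  · rw [hpos 1 one_pos, Real.log_one, neg_zero, hδ.height_zero]
  · intro t ht
    have : {τ | τ ∈ Icc 0 t ∧ Real.exp (τ - t) ≤ x (Real.exp (-τ))} = Icc 0 (δ t) := by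
      ext τ
      constructor
      · rintro ⟨hτ, h⟩
        rw [← neg_sub, hiff τ (t - τ) hτ.1 (sub_nonneg.2 hτ.2), add_sub_cancel] at h
        exact ⟨hτ.1, h⟩
      · intro hτ
        have hτ' : τ ∈ Icc 0 t := ⟨hτ.1, hτ.2.trans (hδ.mem t ht).2⟩
        refine ⟨hτ', ?_⟩
        rw [← neg_sub, hiff τ (t - τ) hτ.1 (sub_nonneg.2 hτ'.2), add_sub_cancel]
        exact hτ.2
    rw [crossing, this, csSup_Icc (hδ.mem t ht).1]

end IsPath

/-- A distribution function on the unit interval is determined almost everywhere by its crossing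
path. -/
lemma IsCDF.eqOn_of_crossing {x y : ℝ → ℝ} (hx : IsCDF x) (hy : IsCDF y)
    (h : ∀ᵐ t ∂volume.restrict (Ioi 0), crossing x t = crossing y t) : EqOn x y (Icc 0 1) := by
  have hint : ∀ u ∈ Icc (0 : ℝ) 1, ∫ s in u..1, x s = ∫ s in u..1, y s := by
    intro u hu
    rcases hu.1.eq_or_lt with rfl | hu0
    · rw [hx.integral_zero_one, hy.integral_zero_one]
      exact integral_congr_ae (h.mono fun t ht => by simp only [ht])
    · have ha : 0 ≤ -Real.log u := neg_nonneg.2 (Real.log_nonpos hu.1 hu.2)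
      have hx1 := hx.integral_Ioc_one ha
      have hy1 := hy.integral_Ioc_one ha
      rw [neg_neg, Real.exp_log hu0] at hx1 hy1
      rw [hx1, hy1]
      exact integral_congr_ae (h.mono fun t ht => by simp only [ht])
  have key : ∀ {x y : ℝ → ℝ}, IsCDF x → IsCDF y →
      (∀ u ∈ Icc (0 : ℝ) 1, ∫ s in u..1, x s = ∫ s in u..1, y s) → ∀ u ∈ Ico (0 : ℝ) 1,
      x u ≤ y u := by
    intro x y hx hy hint u hu
    by_contra! hlt
    -- Right-continuity keeps `y` below the midpoint just to the right of `u`, while `x` stays above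
    -- `x u`; the integrals over that interval would then differ.
    have hev : ∀ᶠ w in 𝓝[≥] u, w ∈ Ico u 1 ∧ y w < (x u + y u) / 2 :=
      Eventually.and (Ico_mem_nhdsGE hu.2)
        ((tendsto_order.1 (hy.2.1 u hu)).2 _ (by linarith))
    obtain ⟨w, hw, hIcc⟩ := (mem_nhdsGE_iff_exists_Icc_subset.1 hev)
    have hw1 := (hIcc (right_mem_Icc.2 (le_of_lt hw))).1
    have hw' : w ∈ Icc (0 : ℝ) 1 := ⟨hu.1.trans hw1.1, hw1.2.le⟩
    have hu' : u ∈ Icc (0 : ℝ) 1 := ⟨hu.1, hu.2.le⟩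
    have hsub : uIcc u w ⊆ Icc 0 1 := by
      rw [uIcc_of_le (le_of_lt hw)]
      exact Icc_subset_Icc hu.1 hw'.2
    have hsub2 : uIcc w 1 ⊆ Icc 0 1 := by
      rw [uIcc_of_le hw'.2]
      exact Icc_subset_Icc_left hw'.1
    have hxi : IntervalIntegrable x volume u w := (hx.1.mono hsub).intervalIntegrable
    have hyi : IntervalIntegrable y volume u w := (hy.1.mono hsub).intervalIntegrable
    have hxi2 : IntervalIntegrable x volume w 1 := (hx.1.mono hsub2).intervalIntegrable
    have hyi2 : IntervalIntegrable y volume w 1 := (hy.1.mono hsub2).intervalIntegrable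
    have h1 := intervalIntegral.integral_add_adjacent_intervals hxi hxi2
    have h2 := intervalIntegral.integral_add_adjacent_intervals hyi hyi2
    have h3 := hint u hu'
    have h4 := hint w hw'
    have h5 : ∫ s in u..w, (x u : ℝ) ≤ ∫ s in u..w, x s := by
      refine intervalIntegral.integral_mono_on (le_of_lt hw) (by simp) hxi fun s hs => ?_
      exact hx.1 hu' ⟨hu.1.trans hs.1, hs.2.trans hw'.2⟩ hs.1
    have h6 : ∫ s in u..w, y s ≤ ∫ s in u..w, (x u + y u) / 2 :=
      intervalIntegral.integral_mono_on (le_of_lt hw) hyi (by simp) fun s hs => (hIcc hs).2.le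
    rw [intervalIntegral.integral_const, smul_eq_mul] at h5 h6
    have hw0 : 0 < w - u := sub_pos.2 hw
    nlinarith
  intro u hu
  rcases hu.2.eq_or_lt with rfl | hu1
  · rw [hx.2.2.2, hy.2.2.2]
  · exact le_antisymm (key hx hy hint u ⟨hu.1, hu1⟩)
      (key hy hx (fun u hu => (hint u hu).symm) u ⟨hu.1, hu1⟩)

/-! ### Integration against a monotone multiplier -/

/-- If all initial integrals of `g` are nonpositive, so is its integral against a nonnegative
nonincreasing weight. -/
lemma integral_antitone_mul_nonpos {lam g : ℝ → ℝ} (hlam : AntitoneOn lam (Ici 0))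
    (hpos : ∀ t, 0 ≤ t → 0 ≤ lam t) (hg : IntegrableOn g (Ioi 0))
    (hle : ∀ t, 0 ≤ t → ∫ s in Ioc 0 t, g s ≤ 0) :
    ∫ t in Ioi (0 : ℝ), lam t * g t ≤ 0 := by
  set l : ℝ → ℝ := fun t => lam (max t 0) with hl
  have hlanti : Antitone l := fun a b hab =>
    hlam (mem_Ici.2 (le_max_right _ _)) (mem_Ici.2 (le_max_right _ _)) (max_le_max_right 0 hab)
  have hle : ∀ t, 0 ≤ t → ∀ A : Set ℝ, Ioo 0 t ⊆ A → A ⊆ Ioc 0 t → ∫ s in A, g s ≤ 0 := by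
    intro t ht A h1 h2
    refine le_of_eq_of_le (setIntegral_congr_set ?_) (hle t ht)
    refine (LE.le.eventuallyLE h2).antisymm ?_
    exact Ioo_ae_eq_Ioc.symm.le.trans (LE.le.eventuallyLE h1)
  -- Layer cake: `lam t` is the length of the levels `q` below it, and for fixed `q` the superlevel
  -- set is an initial interval, where the integral of `g` is nonpositive.
  set K : ℝ → ℝ → ℝ := fun t q => if q < l t then g t else 0 with hK
  have hint : Integrable (Function.uncurry K)
      ((volume.restrict (Ioi 0)).prod (volume.restrict (Ioc 0 (lam 0)))) := by
    have h1 : Integrable (fun z : ℝ × ℝ => g z.1)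
        ((volume.restrict (Ioi 0)).prod (volume.restrict (Ioc 0 (lam 0)))) :=
      Integrable.comp_fst hg _
    have hms : MeasurableSet {z : ℝ × ℝ | z.2 < l z.1} :=
      measurableSet_lt measurable_snd (hlanti.measurable.comp measurable_fst)
    refine (h1.indicator hms).congr (Eventually.of_forall fun z => ?_)
    simp only [hK, Function.uncurry, indicator, mem_ofPred_eq]
  have hswap := integral_integral_swap hint
  have hinner : ∀ t ∈ Ioi (0 : ℝ), ∫ q in Ioc 0 (lam 0), K t q = lam t * g t := by
    intro t ht
    have ht0 : 0 ≤ t := le_of_lt ht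
    have hlt : l t = lam t := by simp only [hl, max_eq_left ht0]
    have h1 : lam t ≤ lam 0 := hlam (by simp) ht0 ht0
    have h2 : lam t * g t = ∫ q in Ioo 0 (lam t), g t := by simp [hpos t ht0]
    rw [h2, ← integral_indicator measurableSet_Ioc, ← integral_indicator measurableSet_Ioo]
    congr 1
    ext q
    simp only [hK, indicator, mem_Ioc, mem_Ioo, hlt]
    by_cases h3 : q < lam t
    · simp [h3, h3.le.trans h1]
    · simp [h3]
  rw [← setIntegral_congr_fun measurableSet_Ioi hinner, hswap]
  refine integral_nonpos fun q => ?_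
  set A : Set ℝ := {t | t ∈ Ioi (0 : ℝ) ∧ q < l t} with hA
  have hAi : ∫ t in Ioi (0 : ℝ), K t q = ∫ t in A, g t := by
    have hms : MeasurableSet {t | q < l t} := measurableSet_lt measurable_const hlanti.measurable
    have : A = Ioi (0 : ℝ) ∩ {t | q < l t} := rfl
    rw [this, ← setIntegral_indicator hms]
    rfl
  change ∫ t in Ioi (0 : ℝ), K t q ≤ 0
  rw [hAi]
  have hlow : ∀ t ∈ A, Ioc 0 t ⊆ A := fun t ht s hs => ⟨hs.1, ht.2.trans_le (hlanti hs.2)⟩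
  rcases A.eq_empty_or_nonempty with h0 | hne
  · rw [h0]
    simp
  · by_cases hb : BddAbove A
    · obtain ⟨a, ha⟩ := hne
      refine hle (sSup A) ((le_of_lt ha.1).trans (le_csSup hb ha)) A ?_ ?_
      · intro s hs
        obtain ⟨b, hbA, hsb⟩ := exists_lt_of_lt_csSup ⟨a, ha⟩ hs.2
        exact hlow b hbA ⟨hs.1, hsb.le⟩
      · exact fun s hs => ⟨hs.1, le_csSup hb hs⟩
    · have hAe : A = Ioi 0 := by
        refine Subset.antisymm (fun s hs => hs.1) fun s hs => ?_
        obtain ⟨b, hbA, hsb⟩ := not_bddAbove_iff.1 hb s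
        exact hlow b hbA ⟨hs, hsb.le⟩
      rw [hAe]
      have ht := intervalIntegral_tendsto_integral_Ioi 0 hg tendsto_id
      refine le_of_tendsto ht ?_
      filter_upwards [eventually_ge_atTop 0] with t ht
      rw [id, intervalIntegral.integral_of_le ht]
      exact hle t ht _ Ioo_subset_Ioc_self Subset.rfl

lemma integrableOn_exp_neg_mul_id : IntegrableOn (fun t : ℝ => Real.exp (-t) * t) (Ioi 0) := by
  refine IntegrableOn.congr_fun (Real.GammaIntegral_convergent (s := 2) (by norm_num))
    (fun t _ => ?_) measurableSet_Ioi
  norm_num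

lemma integral_exp_neg_mul_id : ∫ t in Ioi (0 : ℝ), Real.exp (-t) * t = 1 := by
  rw [← Real.Gamma_two, Real.Gamma_eq_integral (by norm_num)]
  refine setIntegral_congr_fun measurableSet_Ioi fun t _ => ?_
  norm_num

lemma integral_exp_neg_mul_id_Ioc {t : ℝ} (ht : 0 ≤ t) :
    ∫ s in Ioc 0 t, Real.exp (-s) * s = 1 - Real.exp (-t) - Real.exp (-t) * t := by
  rw [← intervalIntegral.integral_of_le ht,
    intervalIntegral.integral_eq_sub_of_hasDerivAt (f := fun s => -Real.exp (-s) - Real.exp (-s) * s)]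
  · simp
    ring
  · intro s _
    have h1 : HasDerivAt (fun s : ℝ => Real.exp (-s)) (-Real.exp (-s)) s := by
      simpa using (hasDerivAt_neg s).exp
    refine (h1.neg.sub (h1.mul (hasDerivAt_id s))).congr_deriv ?_
    simp
  · exact (by fun_prop : Continuous fun s : ℝ => Real.exp (-s) * s).intervalIntegrable _ _

/-! ### Border constraints in terms of crossing paths -/

section Border

variable {ι : Type*} [Fintype ι] {x : ι → ℝ → ℝ}

lemma IsCDF.integrableOn_crossing {x : ℝ → ℝ} (hx : IsCDF x) :
    IntegrableOn (fun t => Real.exp (-t) * crossing x t) (Ioi 0) := by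
  refine integrableOn_exp_neg_mul_id.mono' ?_ ?_
  · refine AEStronglyMeasurable.mul (by fun_prop) ?_
    exact (aemeasurable_restrict_of_monotoneOn measurableSet_Ioi
      (hx.monotoneOn_crossing.mono Ioi_subset_Ici_self)).aestronglyMeasurable
  · filter_upwards [ae_restrict_mem measurableSet_Ioi] with t ht
    rw [norm_mul, Real.norm_of_nonneg (Real.exp_pos _).le,
      Real.norm_of_nonneg (hx.crossing_nonneg (le_of_lt ht))]
    exact mul_le_mul_of_nonneg_left (hx.crossing_le (le_of_lt ht)) (Real.exp_pos _).le

lemma IsCDF.integrableOn_min_crossing {x : ℝ → ℝ} (hx : IsCDF x) {a : ℝ} (ha : 0 ≤ a) :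
    IntegrableOn (fun t => Real.exp (-t) * min (crossing x t) a) (Ioi 0) := by
  refine hx.integrableOn_crossing.mono' ?_ ?_
  · refine AEStronglyMeasurable.mul (by fun_prop) ?_
    exact ((aemeasurable_restrict_of_monotoneOn measurableSet_Ioi
      (hx.monotoneOn_crossing.mono Ioi_subset_Ici_self)).min aemeasurable_const).aestronglyMeasurable
  · filter_upwards [ae_restrict_mem measurableSet_Ioi] with t ht
    rw [norm_mul, Real.norm_of_nonneg (Real.exp_pos _).le,
      Real.norm_of_nonneg (le_min (hx.crossing_nonneg (le_of_lt ht)) ha)]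
    exact mul_le_mul_of_nonneg_left (min_le_left _ _) (Real.exp_pos _).le

/-- The Border constraints bound the initial integrals of the aggregate crossing path. -/
lemma Border.integral_crossing_le (hB : Border x) (hx : ∀ i, IsCDF (x i)) {t : ℝ} (ht : 0 ≤ t) :
    ∫ s in Ioc 0 t, Real.exp (-s) * (∑ i, crossing (x i) s - s) ≤ 0 := by
  have hc := fun i => (hx i).crossing_mem ht
  have h1 := hB (fun i => Real.exp (-crossing (x i) t)) fun i => exp_neg_mem (hc i).1
  rw [← Real.exp_sum, Finset.sum_neg_distrib] at h1
  have h2 : ∀ i, ∫ s in Real.exp (-crossing (x i) t)..1, x i s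
      = (∫ s in Ioc 0 t, Real.exp (-s) * crossing (x i) s) + Real.exp (-t) * crossing (x i) t := by
    intro i
    have hI := (hx i).integrableOn_min_crossing (hc i).1
    rw [(hx i).integral_Ioc_one (hc i).1, ← Ioc_union_Ioi_eq_Ioi ht,
      setIntegral_union (Ioc_disjoint_Ioi le_rfl) measurableSet_Ioi
        (hI.mono_set Ioc_subset_Ioi_self) (hI.mono_set (Ioi_subset_Ioi ht))]
    congr 1
    · refine setIntegral_congr_fun measurableSet_Ioc fun s hs => ?_
      simp only [min_eq_left ((hx i).monotoneOn_crossing (le_of_lt hs.1) ht hs.2)]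
    · rw [← integral_exp_neg_Ioi t, ← integral_mul_const]
      refine setIntegral_congr_fun measurableSet_Ioi fun s hs => ?_
      simp only [min_eq_right ((hx i).monotoneOn_crossing ht (ht.trans (le_of_lt hs))
        (le_of_lt hs))]
  rw [Finset.sum_congr rfl fun i _ => h2 i, Finset.sum_add_distrib, ← Finset.mul_sum,
    ← integral_finsetSum _ fun i _ =>
      (hx i).integrableOn_crossing.mono_set Ioc_subset_Ioi_self] at h1
  have h3 : ∫ s in Ioc 0 t, Real.exp (-s) * (∑ i, crossing (x i) s - s)
      = (∫ s in Ioc 0 t, ∑ i, Real.exp (-s) * crossing (x i) s)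
        - ∫ s in Ioc 0 t, Real.exp (-s) * s := by
    rw [← integral_sub]
    · simp only [mul_sub, Finset.mul_sum]
    · exact integrable_finsetSum _ fun i _ =>
        (hx i).integrableOn_crossing.mono_set Ioc_subset_Ioi_self
    · exact integrableOn_exp_neg_mul_id.mono_set Ioc_subset_Ioi_self
  rw [h3, integral_exp_neg_mul_id_Ioc ht]
  -- The bound `1 + z ≤ e^z` removes the boundary terms left after `t`; it is sharp exactly when the
  -- paths add up to `t`.
  have h4 := Real.add_one_le_exp (t - ∑ i, crossing (x i) t)
  have h5 : Real.exp (-t) * Real.exp (t - ∑ i, crossing (x i) t)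
      = Real.exp (-∑ i, crossing (x i) t) := by
    rw [← Real.exp_add]
    ring_nf
  have h6 := mul_le_mul_of_nonneg_left h4 (Real.exp_pos (-t)).le
  rw [h5] at h6
  linarith

/-- Distribution functions whose aggregate crossing path never runs ahead of time satisfy the
Border constraints. -/
lemma border_of_sum_crossing_le (hx : ∀ i, IsCDF (x i))
    (hle : ∀ t, 0 ≤ t → ∑ i, crossing (x i) t ≤ t) : Border x := by
  intro u hu
  -- A zero quantile has no logarithm, but it kills the product, and all integrals may then be
  -- extended to `[0, 1]`.
  by_cases h0 : ∃ i, u i = 0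
  · obtain ⟨i, hi⟩ := h0
    rw [Finset.prod_eq_zero (Finset.mem_univ i) hi, zero_add]
    have h1 : ∀ j, ∫ s in (u j)..1, x j s
        ≤ ∫ t in Ioi (0 : ℝ), Real.exp (-t) * crossing (x j) t := by
      intro j
      rw [← (hx j).integral_zero_one]
      refine intervalIntegral.integral_mono_interval (hu j).1 (hu j).2 le_rfl ?_ ?_
      · filter_upwards [ae_restrict_mem measurableSet_Ioc] with s hs
        exact ((hx j).mem_Icc ⟨hs.1.le, hs.2⟩).1
      · exact ((hx j).1.mono (by rw [uIcc_of_le zero_le_one])).intervalIntegrable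
    refine (Finset.sum_le_sum fun j _ => h1 j).trans ?_
    rw [← integral_finsetSum _ fun j _ => (hx j).integrableOn_crossing,
      ← integral_exp_neg_mul_id]
    refine setIntegral_mono_on (integrable_finsetSum _ fun j _ => (hx j).integrableOn_crossing)
      integrableOn_exp_neg_mul_id measurableSet_Ioi fun t ht => ?_
    rw [← Finset.mul_sum]
    exact mul_le_mul_of_nonneg_left (hle t (le_of_lt ht)) (Real.exp_pos _).le
  · push Not at h0
    have hpos : ∀ i, 0 < u i := fun i => lt_of_le_of_ne (hu i).1 (h0 i).symm
    set a : ι → ℝ := fun i => -Real.log (u i) with ha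
    have ha0 : ∀ i, 0 ≤ a i := fun i => neg_nonneg.2 (Real.log_nonpos (hu i).1 (hu i).2)
    have hua : ∀ i, u i = Real.exp (-a i) := fun i => by simp [ha, Real.exp_log (hpos i)]
    set A : ℝ := ∑ i, a i with hA
    have hA0 : 0 ≤ A := Finset.sum_nonneg fun i _ => ha0 i
    have hprod : ∏ i, u i = Real.exp (-A) := by
      rw [Finset.prod_congr rfl fun i _ => hua i, ← Real.exp_sum, Finset.sum_neg_distrib]
    have hsum : ∑ i, ∫ s in (u i)..1, x i s
        = ∫ t in Ioi (0 : ℝ), ∑ i, Real.exp (-t) * min (crossing (x i) t) (a i) := by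
      rw [integral_finsetSum _ fun i _ => (hx i).integrableOn_min_crossing (ha0 i)]
      exact Finset.sum_congr rfl fun i _ => by rw [hua i, (hx i).integral_Ioc_one (ha0 i)]
    have hI : IntegrableOn (fun t => Real.exp (-t) * min t A) (Ioi 0) := by
      refine integrableOn_exp_neg_mul_id.mono' (by fun_prop) ?_
      filter_upwards [ae_restrict_mem measurableSet_Ioi] with t ht
      rw [norm_mul, Real.norm_of_nonneg (Real.exp_pos _).le,
        Real.norm_of_nonneg (le_min (le_of_lt ht) hA0)]
      exact mul_le_mul_of_nonneg_left (min_le_left _ _) (Real.exp_pos _).le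
    have hbound : ∫ t in Ioi (0 : ℝ), ∑ i, Real.exp (-t) * min (crossing (x i) t) (a i)
        ≤ ∫ t in Ioi (0 : ℝ), Real.exp (-t) * min t A := by
      refine setIntegral_mono_on (integrable_finsetSum _ fun i _ =>
        (hx i).integrableOn_min_crossing (ha0 i)) hI measurableSet_Ioi fun t ht => ?_
      rw [← Finset.mul_sum]
      refine mul_le_mul_of_nonneg_left (le_min ?_ ?_) (Real.exp_pos _).le
      · exact (Finset.sum_le_sum fun i _ => min_le_left _ _).trans (hle t (le_of_lt ht))
      · exact Finset.sum_le_sum fun i _ => min_le_right _ _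
    have hval : ∫ t in Ioi (0 : ℝ), Real.exp (-t) * min t A = 1 - Real.exp (-A) := by
      rw [← Ioc_union_Ioi_eq_Ioi hA0,
        setIntegral_union (Ioc_disjoint_Ioi le_rfl) measurableSet_Ioi
          (hI.mono_set Ioc_subset_Ioi_self) (hI.mono_set (Ioi_subset_Ioi hA0)),
        setIntegral_congr_fun (g := fun s => Real.exp (-s) * s) measurableSet_Ioc
          (fun s hs => by simp only [min_eq_left hs.2]),
        setIntegral_congr_fun (g := fun s => Real.exp (-s) * A) measurableSet_Ioi
          (fun s hs => by simp only [min_eq_right (le_of_lt (mem_Ioi.1 hs))]),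
        integral_mul_const, integral_exp_neg_Ioi, integral_exp_neg_mul_id_Ioc hA0]
      ring
    rw [hprod, hsum]
    linarith

end Border

/-! ### Marginal revenue and revenue in logarithmic coordinates -/

lemma marginalRevenue_eq (h : ℝ → ℝ) (F : TypeDist) (τ t : ℝ) : marginalRevenue h F τ t
    = F.virtualValue (Real.exp (-τ)) * derivWithin h (Icc 0 1) (Real.exp (τ - t)) := by
  unfold marginalRevenue dHdx H J
  rw [derivWithin_const_mul_field]
  rfl

section Transform

variable {h : ℝ → ℝ}

lemma continuousOn_derivWithin_of_contDiffOn (hs : ContDiffOn ℝ 2 h (Icc 0 1)) :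
    ContinuousOn (derivWithin h (Icc 0 1)) (Icc 0 1) :=
  hs.continuousOn_derivWithin (uniqueDiffOn_Icc zero_lt_one) (by norm_num)

lemma derivWithin_eq_deriv {x : ℝ} (hx : x ∈ Ioo (0 : ℝ) 1) :
    derivWithin h (Icc 0 1) x = deriv h x :=
  derivWithin_of_mem_nhds (Icc_mem_nhds hx.1 hx.2)

lemma strictMonoOn_derivWithin (hs : ContDiffOn ℝ 2 h (Icc 0 1))
    (h2 : ∀ x ∈ Ioo (0 : ℝ) 1, 0 < deriv (deriv h) x) :
    StrictMonoOn (derivWithin h (Icc 0 1)) (Icc 0 1) := by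
  refine strictMonoOn_of_deriv_pos (convex_Icc 0 1) (continuousOn_derivWithin_of_contDiffOn hs)
    fun x hx => ?_
  rw [interior_Icc] at hx
  have : derivWithin h (Icc 0 1) =ᶠ[𝓝 x] deriv h := by
    filter_upwards [Ioo_mem_nhds hx.1 hx.2] with y hy using derivWithin_eq_deriv hy
  rw [this.deriv_eq]
  exact h2 x hx

lemma derivWithin_pos (hs : ContDiffOn ℝ 2 h (Icc 0 1)) (h1 : ∀ x ∈ Ioo (0 : ℝ) 1, 0 < deriv h x)
    (h2 : ∀ x ∈ Ioo (0 : ℝ) 1, 0 < deriv (deriv h) x) {x : ℝ} (hx : x ∈ Ioc (0 : ℝ) 1) :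
    0 < derivWithin h (Icc 0 1) x := by
  have hm : x / 2 ∈ Ioo (0 : ℝ) 1 := ⟨by linarith [hx.1], by linarith [hx.1, hx.2]⟩
  refine (h1 _ hm).trans ?_
  rw [← derivWithin_eq_deriv hm]
  exact strictMonoOn_derivWithin hs h2 (Ioo_subset_Icc_self hm) (Ioc_subset_Icc_self hx)
    (by linarith [hx.1])

lemma integral_derivWithin (hs : ContDiffOn ℝ 2 h (Icc 0 1)) {x : ℝ} (hx : x ∈ Icc (0 : ℝ) 1) :
    ∫ y in (0 : ℝ)..x, derivWithin h (Icc 0 1) y = h x - h 0 := by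
  have hsub : Icc 0 x ⊆ Icc (0 : ℝ) 1 := Icc_subset_Icc_right hx.2
  refine intervalIntegral.integral_eq_sub_of_hasDerivAt_of_le hx.1 (hs.continuousOn.mono hsub) ?_ ?_
  · intro y hy
    have hy' : y ∈ Ioo (0 : ℝ) 1 := ⟨hy.1, hy.2.trans_le hx.2⟩
    exact ((hs.differentiableOn (by norm_num) y
      (Ioo_subset_Icc_self hy')).hasDerivWithinAt).hasDerivAt (Icc_mem_nhds hy'.1 hy'.2)
  · apply ContinuousOn.intervalIntegrable
    rw [uIcc_of_le hx.1]
    exact (continuousOn_derivWithin_of_contDiffOn hs).mono hsub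

lemma monotoneOn_of_transform (hs : ContDiffOn ℝ 2 h (Icc 0 1))
    (h1 : ∀ x ∈ Ioo (0 : ℝ) 1, 0 < deriv h x) : MonotoneOn h (Icc 0 1) := by
  refine (strictMonoOn_of_deriv_pos (convex_Icc 0 1) hs.continuousOn fun x hx => ?_).monotoneOn
  rw [interior_Icc] at hx
  exact h1 x hx

end Transform

lemma exp_sub_mem_Ioc {s t : ℝ} (hs : s ≤ t) : Real.exp (s - t) ∈ Ioc (0 : ℝ) 1 :=
  ⟨Real.exp_pos _, (exp_sub_mem hs).2⟩

section MarginalRevenue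

variable {h : ℝ → ℝ} {F : TypeDist}

/-- Marginal revenue extends continuously, and boundedly, to the whole plane. -/
lemma exists_continuous_marginalRevenue (hs : ContDiffOn ℝ 2 h (Icc 0 1)) (F : TypeDist) :
    ∃ M : ℝ → ℝ → ℝ, Continuous (Function.uncurry M) ∧ (∃ C, ∀ τ t, |M τ t| ≤ C) ∧
      ∀ t τ, τ ∈ Icc 0 t → M τ t = marginalRevenue h F τ t := by
  obtain ⟨v, hvc, ⟨Cv, hCv⟩, hv⟩ := exists_continuous_extension F.continuousOn_virtualValue
  obtain ⟨k, hkc, ⟨Ck, hCk⟩, hk⟩ :=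
    exists_continuous_extension (continuousOn_derivWithin_of_contDiffOn hs)
  refine ⟨fun τ t => v (Real.exp (-τ)) * k (Real.exp (τ - t)), ?_, ⟨Cv * Ck, fun τ t => ?_⟩,
    fun t τ hτ => ?_⟩
  · unfold Function.uncurry
    fun_prop
  · rw [abs_mul]
    exact mul_le_mul (hCv _) (hCk _) (abs_nonneg _) ((abs_nonneg _).trans (hCv 0))
  · simp only [marginalRevenue_eq, hv _ (exp_neg_mem hτ.1), hk _ (exp_sub_mem hτ.2)]

lemma hasDerivWithinAt_R (hs : ContDiffOn ℝ 2 h (Icc 0 1)) {t d : ℝ} (hd : d ∈ Icc 0 t) :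
    HasDerivWithinAt (fun d => R h F d t) (marginalRevenue h F d t) (Icc 0 t) d := by
  obtain ⟨M, hMc, -, hM⟩ := exists_continuous_marginalRevenue hs F
  have hMt : Continuous fun τ => M τ t :=
    hMc.comp (f := fun τ => (τ, t)) (by fun_prop)
  have h1 := (hMt.integral_hasStrictDerivAt 0 d).hasDerivAt.hasDerivWithinAt (s := Icc 0 t)
  rw [hM t d hd] at h1
  have heq : ∀ e ∈ Icc 0 t, R h F e t = ∫ τ in (0 : ℝ)..e, M τ t := by
    intro e he
    refine intervalIntegral.integral_congr fun τ hτ => ?_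
    rw [uIcc_of_le he.1] at hτ
    exact (hM t τ ⟨hτ.1, hτ.2.trans he.2⟩).symm
  exact h1.congr heq (heq d hd)

lemma strictAntiOn_marginalRevenue (hs : ContDiffOn ℝ 2 h (Icc 0 1)) {t : ℝ}
    (hR : StrictConcaveOn ℝ (Icc 0 t) fun δ => R h F δ t) :
    StrictAntiOn (fun d => marginalRevenue h F d t) (Icc 0 t) := by
  have h1 := hR.strictAntiOn_derivWithin fun d hd =>
    (hasDerivWithinAt_R hs hd).differentiableWithinAt
  intro d hd e he hde
  have ht : (0 : ℝ) < t := hd.1.trans_lt (hde.trans_le he.2)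
  have h2 := h1 hd he hde
  rwa [(hasDerivWithinAt_R hs hd).derivWithin (uniqueDiffOn_Icc ht d hd),
    (hasDerivWithinAt_R hs he).derivWithin (uniqueDiffOn_Icc ht e he)] at h2

/-- The tangent line at `e` lies strictly above a strictly concave revenue function. -/
lemma R_lt_tangent (hs : ContDiffOn ℝ 2 h (Icc 0 1)) {t d e : ℝ}
    (hR : StrictConcaveOn ℝ (Icc 0 t) fun δ => R h F δ t) (hd : d ∈ Icc 0 t) (he : e ∈ Icc 0 t)
    (hde : d ≠ e) : R h F d t < R h F e t + marginalRevenue h F e t * (d - e) := by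
  have hanti := strictAntiOn_marginalRevenue hs hR
  have key : ∀ a ∈ Icc 0 t, ∀ b ∈ Icc 0 t, a < b →
      ∃ c ∈ Ioo a b, marginalRevenue h F c t * (b - a) = R h F b t - R h F a t := by
    intro a ha b hb hab
    have hsub : Icc a b ⊆ Icc 0 t := Icc_subset_Icc ha.1 hb.2
    obtain ⟨c, hc, hceq⟩ := exists_hasDerivAt_eq_slope (fun d => R h F d t)
      (fun d => marginalRevenue h F d t) hab
      (fun x hx => (hasDerivWithinAt_R hs (hsub hx)).continuousWithinAt.mono hsub)
      (fun x hx => (hasDerivWithinAt_R hs (hsub (Ioo_subset_Icc_self hx))).hasDerivAt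
        (Icc_mem_nhds (ha.1.trans_lt hx.1) (hx.2.trans_le hb.2)))
    exact ⟨c, hc, by rw [hceq, div_mul_cancel₀ _ (sub_pos.2 hab).ne']⟩
  rcases lt_or_gt_of_ne hde with hlt | hlt
  · obtain ⟨c, hc, hceq⟩ := key d hd e he hlt
    have h1 := hanti (show c ∈ Icc 0 t from ⟨hd.1.trans hc.1.le, hc.2.le.trans he.2⟩) he hc.2
    simp only at h1
    nlinarith [sub_pos.2 hlt]
  · obtain ⟨c, hc, hceq⟩ := key e he d hd hlt
    have h1 := hanti he (show c ∈ Icc 0 t from ⟨he.1.trans hc.1.le, hc.2.le.trans hd.2⟩) hc.1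
    simp only at h1
    nlinarith [sub_pos.2 hlt]

/-- Marginal revenue is bounded by a constant, so `|R|` is at most that constant times the crossing
path. -/
lemma IsCDF.integrableOn_R {x : ℝ → ℝ} (hx : IsCDF x) (hs : ContDiffOn ℝ 2 h (Icc 0 1))
    (F : TypeDist) : IntegrableOn (fun t => Real.exp (-t) * R h F (crossing x t) t) (Ioi 0) := by
  obtain ⟨M, hMc, ⟨C, hC⟩, hM⟩ := exists_continuous_marginalRevenue hs F
  have hcont : Continuous fun z : ℝ × ℝ => ∫ τ in (0 : ℝ)..z.1, M τ z.2 := by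
    refine intervalIntegral.continuous_parametric_intervalIntegral_of_continuous
      (f := fun (z : ℝ × ℝ) τ => M τ z.2) ?_ continuous_fst
    exact hMc.comp (f := fun w : (ℝ × ℝ) × ℝ => (w.2, w.1.2)) (by fun_prop)
  have heq : ∀ t ∈ Ioi (0 : ℝ),
      R h F (crossing x t) t = ∫ τ in (0 : ℝ)..crossing x t, M τ t := by
    intro t ht
    have hc := hx.crossing_mem (le_of_lt ht)
    refine intervalIntegral.integral_congr fun τ hτ => ?_
    rw [uIcc_of_le hc.1] at hτ
    exact (hM t τ ⟨hτ.1, hτ.2.trans hc.2⟩).symm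
  have hcm : AEMeasurable (crossing x) (volume.restrict (Ioi 0)) :=
    aemeasurable_restrict_of_monotoneOn measurableSet_Ioi
      (hx.monotoneOn_crossing.mono Ioi_subset_Ici_self)
  have h1 : IntegrableOn (fun t => Real.exp (-t) * ∫ τ in (0 : ℝ)..crossing x t, M τ t)
      (Ioi 0) := by
    refine (hx.integrableOn_crossing.const_mul C).mono' ?_ ?_
    · refine AEStronglyMeasurable.mul (by fun_prop) ?_
      exact (hcont.measurable.comp_aemeasurable
        (hcm.prodMk aemeasurable_id)).aestronglyMeasurable
    · filter_upwards [ae_restrict_mem measurableSet_Ioi] with t ht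
      have hc := hx.crossing_mem (le_of_lt ht)
      rw [norm_mul, Real.norm_of_nonneg (Real.exp_pos _).le, mul_left_comm]
      refine mul_le_mul_of_nonneg_left ?_ (Real.exp_pos _).le
      have := intervalIntegral.norm_integral_le_of_norm_le_const (a := 0) (b := crossing x t)
        (f := fun τ => M τ t) (C := C) fun τ _ => hC τ t
      rwa [sub_zero, abs_of_nonneg hc.1] at this
  exact h1.congr_fun (fun t ht => by simp only [heq t ht]) measurableSet_Ioi

/-- Expected revenue in logarithmic coordinates. -/
lemma IsCDF.integral_H {x : ℝ → ℝ} (hx : IsCDF x) (hs : ContDiffOn ℝ 2 h (Icc 0 1))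
    (h1 : ∀ x ∈ Ioo (0 : ℝ) 1, 0 < deriv h x) (F : TypeDist) :
    ∫ u in (0 : ℝ)..1, H h F (x u) u = (∫ u in (0 : ℝ)..1, F.virtualValue u * h 0)
      + ∫ t in Ioi (0 : ℝ), Real.exp (-t) * R h F (crossing x t) t := by
  have hv : ContinuousOn F.virtualValue (uIcc 0 1) := by
    rw [uIcc_of_le zero_le_one]
    exact F.continuousOn_virtualValue
  have hsub := hx.integral_subgraph F.continuousOn_virtualValue
    (continuousOn_derivWithin_of_contDiffOn hs)
  have hR : ∀ t, ∫ τ in (0 : ℝ)..crossing x t, F.virtualValue (Real.exp (-τ)) *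
      derivWithin h (Icc 0 1) (Real.exp (τ - t)) = R h F (crossing x t) t := fun t =>
    intervalIntegral.integral_congr fun τ _ => (marginalRevenue_eq h F τ t).symm
  simp only [hR] at hsub
  -- Since `x` may jump, integrability comes from monotonicity rather than continuity.
  have hmono : MonotoneOn (fun u => ∫ y in (0 : ℝ)..x u, derivWithin h (Icc 0 1) y)
      (uIcc 0 1) := by
    rw [uIcc_of_le zero_le_one]
    intro a ha b hb hab
    simp only
    rw [integral_derivWithin hs (hx.mem_Icc ha), integral_derivWithin hs (hx.mem_Icc hb)]
    exact sub_le_sub_right (monotoneOn_of_transform hs h1 (hx.mem_Icc ha) (hx.mem_Icc hb)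
      (hx.1 ha hb hab)) _
  rw [← hsub, ← intervalIntegral.integral_add]
  · refine intervalIntegral.integral_congr fun u hu => ?_
    rw [uIcc_of_le zero_le_one] at hu
    simp only [integral_derivWithin hs (hx.mem_Icc hu), H, J, TypeDist.virtualValue]
    ring
  · exact (hv.mul continuousOn_const).intervalIntegrable
  · exact hmono.intervalIntegrable.continuousOn_mul hv

end MarginalRevenue

/-! ### Optimality and uniqueness by a multiplier -/

section Verification

variable {ι : Type*} [Fintype ι] {h : ℝ → ℝ} {F : ι → TypeDist} {x y : ι → ℝ → ℝ}

lemma revenue_eq (hs : ContDiffOn ℝ 2 h (Icc 0 1)) (h1 : ∀ x ∈ Ioo (0 : ℝ) 1, 0 < deriv h x)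
    (hx : ∀ i, IsCDF (x i)) :
    revenue h F x = (∑ i, ∫ u in (0 : ℝ)..1, (F i).virtualValue u * h 0)
      + ∫ t in Ioi (0 : ℝ), ∑ i, Real.exp (-t) * R h (F i) (crossing (x i) t) t := by
  rw [revenue, integral_finsetSum _ fun i _ => (hx i).integrableOn_R hs (F i),
    ← Finset.sum_add_distrib]
  exact Finset.sum_congr rfl fun i _ => (hx i).integral_H hs h1 (F i)

/-- Verification of optimality: `lam t` is the common marginal revenue of all bidders at time `t`
along the crossing paths of `x`, and `lam` vanishes where these paths do not add up to `t`. -/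
theorem verification (hs : ContDiffOn ℝ 2 h (Icc 0 1)) (h1 : ∀ x ∈ Ioo (0 : ℝ) 1, 0 < deriv h x)
    (hR : ∀ i, ∀ t : ℝ, 0 ≤ t → StrictConcaveOn ℝ (Icc 0 t) fun δ => R h (F i) δ t)
    (hx : ∀ i, IsCDF (x i)) {lam : ℝ → ℝ} (hlam : AntitoneOn lam (Ici 0))
    (hpos : ∀ t, 0 ≤ t → 0 ≤ lam t)
    (hmarg : ∀ t, 0 ≤ t → ∀ i, marginalRevenue h (F i) (crossing (x i) t) t = lam t)
    (hslack : ∀ t, 0 ≤ t → lam t * (∑ i, crossing (x i) t) = lam t * t)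
    (hy : Feasible y) : revenue h F y ≤ revenue h F x ∧
      (revenue h F x ≤ revenue h F y → ∀ i, EqOn (y i) (x i) (Icc 0 1)) := by
  set g : ℝ → ℝ := fun t => Real.exp (-t) * (∑ i, crossing (y i) t - t) with hg
  have hgi : IntegrableOn g (Ioi 0) := by
    have := (integrable_finsetSum Finset.univ
      fun i _ => (hy.1 i).integrableOn_crossing).sub integrableOn_exp_neg_mul_id
    refine this.congr (Eventually.of_forall fun t => ?_)
    simp only [hg, mul_sub, Finset.mul_sum, Pi.sub_apply]
  have habel := integral_antitone_mul_nonpos hlam hpos hgi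
    fun t ht => hy.2.integral_crossing_le hy.1 ht
  have hlgi : IntegrableOn (fun t => lam t * g t) (Ioi 0) := by
    refine (hgi.norm.const_mul (lam 0)).mono' ?_ ?_
    · exact ((aemeasurable_restrict_of_antitoneOn measurableSet_Ioi
        (hlam.mono Ioi_subset_Ici_self)).aestronglyMeasurable).mul hgi.aestronglyMeasurable
    · filter_upwards [ae_restrict_mem measurableSet_Ioi] with t ht
      have ht' : 0 ≤ t := le_of_lt ht
      rw [norm_mul, Real.norm_of_nonneg (hpos t ht')]
      exact mul_le_mul_of_nonneg_right (hlam (by simp) ht' ht') (norm_nonneg _)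
  have hIx := integrable_finsetSum Finset.univ fun i _ => (hx i).integrableOn_R hs (F i)
  have hIy := integrable_finsetSum Finset.univ fun i _ => (hy.1 i).integrableOn_R hs (F i)
  -- The gap between the tangent at the candidate's crossing point and `R` at the competitor's; it
  -- vanishes only if the two points coincide.
  set gap : ι → ℝ → ℝ := fun i t => R h (F i) (crossing (x i) t) t
    + lam t * (crossing (y i) t - crossing (x i) t) - R h (F i) (crossing (y i) t) t with hgap
  have hgap_nonneg : ∀ t, 0 ≤ t → ∀ i, 0 ≤ gap i t ∧
      (gap i t = 0 → crossing (y i) t = crossing (x i) t) := by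
    intro t ht i
    by_cases he : crossing (y i) t = crossing (x i) t
    · simp [hgap, he]
    · have := R_lt_tangent hs (hR i t ht) ((hy.1 i).crossing_mem ht) ((hx i).crossing_mem ht) he
      rw [hmarg t ht i] at this
      have hp : 0 < gap i t := by
        simp only [hgap]
        linarith
      exact ⟨hp.le, fun h0 => absurd h0 hp.ne'⟩
  have hsum : ∀ t ∈ Ioi (0 : ℝ), Real.exp (-t) * ∑ i, gap i t
      = ∑ i, Real.exp (-t) * R h (F i) (crossing (x i) t) t + lam t * g t
        - ∑ i, Real.exp (-t) * R h (F i) (crossing (y i) t) t := by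
    intro t ht
    have h2 := hslack t (le_of_lt ht)
    simp only [hgap, hg, Finset.sum_sub_distrib, Finset.sum_add_distrib, ← Finset.mul_sum]
    linear_combination (-Real.exp (-t)) * h2
  have hadd : Integrable (fun t => ∑ i, Real.exp (-t) * R h (F i) (crossing (x i) t) t
      + lam t * g t) (volume.restrict (Ioi 0)) := hIx.add hlgi
  have hgi_all : IntegrableOn (fun t => Real.exp (-t) * ∑ i, gap i t) (Ioi 0) :=
    IntegrableOn.congr_fun (hadd.sub hIy) (fun t ht => (hsum t ht).symm)
      measurableSet_Ioi
  have htotal : ∫ t in Ioi (0 : ℝ), Real.exp (-t) * ∑ i, gap i t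
      = revenue h F x - revenue h F y + ∫ t in Ioi (0 : ℝ), lam t * g t := by
    rw [setIntegral_congr_fun measurableSet_Ioi hsum, integral_sub hadd hIy,
      integral_add hIx hlgi, revenue_eq hs h1 hx, revenue_eq hs h1 hy.1]
    ring
  have hnonneg : 0 ≤ᵐ[volume.restrict (Ioi 0)] fun t => Real.exp (-t) * ∑ i, gap i t := by
    filter_upwards [ae_restrict_mem measurableSet_Ioi] with t ht
    exact mul_nonneg (Real.exp_pos _).le
      (Finset.sum_nonneg fun i _ => (hgap_nonneg t (le_of_lt ht) i).1)
  have hI := integral_nonneg_of_ae hnonneg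
  refine ⟨by linarith, fun hle i => ?_⟩
  have hzero := (integral_eq_zero_iff_of_nonneg_ae hnonneg hgi_all).1 (by linarith)
  refine (hy.1 i).eqOn_of_crossing (hx i) ?_
  filter_upwards [hzero, ae_restrict_mem measurableSet_Ioi] with t ht0 ht
  have h3 := (mul_eq_zero.1 ht0).resolve_left (Real.exp_pos _).ne'
  rw [Finset.sum_eq_zero_iff_of_nonneg fun i _ => (hgap_nonneg t (le_of_lt ht) i).1] at h3
  exact (hgap_nonneg t (le_of_lt ht) i).2 (h3 i (Finset.mem_univ i))

end Verification

/-- The complement splits as `(c t - δ (c t)) + (t - c t)`, a sum of nondecreasing terms. -/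
lemma IsPath.comp {δ c : ℝ → ℝ} (hδ : IsPath δ) (hc : IsPath c) : IsPath fun t => δ (c t) where
  mem t ht := ⟨(hδ.mem _ (hc.mem t ht).1).1, (hδ.mem _ (hc.mem t ht).1).2.trans (hc.mem t ht).2⟩
  mono s hs t ht hst := hδ.mono (hc.mem s hs).1 (hc.mem t ht).1 (hc.mono hs ht hst)
  mono_sub s hs t ht hst := by
    have h1 := hδ.mono_sub (hc.mem s hs).1 (hc.mem t ht).1 (hc.mono hs ht hst)
    have h2 := hc.mono_sub hs ht hst
    simp only at h1 h2 ⊢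
    linarith

/-- A clock that stops when the price `p` reaches zero. -/
lemma exists_clock {p : ℝ → ℝ} (hp : StrictAntiOn p (Ici 0)) (hc : ContinuousOn p (Ici 0))
    (h0 : 0 ≤ p 0) : ∃ c : ℝ → ℝ, IsPath c ∧ (∀ t, 0 ≤ t → 0 ≤ p (c t)) ∧
      (∀ t, 0 ≤ t → c t = t ∨ p (c t) = 0) ∧ ∀ t, 0 ≤ t → 0 ≤ p t → c t = t := by
  by_cases hall : ∀ t, 0 ≤ t → 0 ≤ p t
  · refine ⟨id, ⟨fun t ht => ⟨ht, le_rfl⟩, monotoneOn_id, ?_⟩, hall, fun t _ => Or.inl rfl,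
      fun t _ _ => rfl⟩
    intro s _ t _ _
    simp
  · push Not at hall
    obtain ⟨s, hs, hps⟩ := hall
    obtain ⟨T, hT, hpT⟩ := intermediate_value_Icc' hs (hc.mono Icc_subset_Ici_self)
      ⟨hps.le, h0⟩
    have hT0 : 0 ≤ T := hT.1
    refine ⟨fun t => min t T, ⟨fun t ht => ⟨le_min ht hT.1, min_le_left _ _⟩,
      fun a _ b _ hab => min_le_min_right T hab, fun a _ b _ hab => ?_⟩, fun t ht => ?_,
      fun t _ => ?_, fun t ht hpt => ?_⟩
    · simp only
      rcases le_total a T with h | h <;> rcases le_total b T with h' | h' <;> simp [h, h'] <;>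
        linarith
    · rw [← hpT]
      exact hp.antitoneOn (le_min ht hT0) hT0 (min_le_right _ _)
    · rcases le_total t T with h | h
      · exact Or.inl (min_eq_left h)
      · right
        simp only [min_eq_right h, hpT]
    · refine min_eq_left ?_
      rw [← hpT] at hpt
      exact (hp.le_iff_ge hT0 ht).1 hpt

/-! ### The static system: prices and speeds -/

section System

variable {ι : Type*} [Fintype ι] {h : ℝ → ℝ} {F : ι → TypeDist}

lemma SolvesSystem.le {t p : ℝ} {δ : ι → ℝ} (hsol : SolvesSystem h F t δ p) (i : ι) :
    δ i ≤ t := by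
  rw [← hsol.2.2]
  exact Finset.single_le_sum (fun j _ => hsol.1 j) (Finset.mem_univ i)

lemma SolvesSystem.price_eq {t p : ℝ} {δ : ι → ℝ} (hsol : SolvesSystem h F t δ p) (i : ι) :
    p = (F i).virtualValue (Real.exp (-δ i)) * derivWithin h (Icc 0 1) (Real.exp (δ i - t)) := by
  rw [← hsol.2.1 i, marginalRevenue_eq]

/-- As the coordinates add up to `t`, the complement of one is the sum of the others, hence
nondecreasing. -/
lemma isPath_of_solvesSystem {δ : ℝ → ι → ℝ} {p : ℝ → ℝ}
    (hsol : ∀ t, 0 ≤ t → SolvesSystem h F t (δ t) (p t))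
    (hmono : ∀ i, MonotoneOn (fun t => δ t i) (Ici 0)) (i : ι) : IsPath fun t => δ t i where
  mem t ht := ⟨(hsol t ht).1 i, (hsol t ht).le i⟩
  mono := hmono i
  mono_sub s hs t ht hst := by
    have h1 : δ t i - δ s i ≤ ∑ j, (δ t j - δ s j) :=
      Finset.single_le_sum (f := fun j => δ t j - δ s j)
        (fun j _ => sub_nonneg.2 (hmono j hs ht hst)) (Finset.mem_univ i)
    rw [Finset.sum_sub_distrib, (hsol t ht).2.2, (hsol s hs).2.2] at h1
    simp only
    linarith

variable {t p : ℝ} {δ : ι → ℝ}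

lemma SolvesSystem.price_nonneg_iff (hsol : SolvesSystem h F t δ p)
    (hk : ∀ y ∈ Ioc (0 : ℝ) 1, 0 < derivWithin h (Icc 0 1) y) (i : ι) :
    0 ≤ p ↔ 0 ≤ (F i).virtualValue (Real.exp (-δ i)) := by
  rw [hsol.price_eq i]
  exact mul_nonneg_iff_of_pos_right (hk _ (exp_sub_mem_Ioc (hsol.le i)))

/-- At nonnegative prices, the bidder whose type distribution is lower in the star order moves
faster. -/
lemma SolvesSystem.le_of_starGe (hsol : SolvesSystem h F t δ p)
    (hk : ∀ y ∈ Ioc (0 : ℝ) 1, 0 < derivWithin h (Icc 0 1) y) (hp : 0 ≤ p) {i j : ι}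
    (hanti : StrictAntiOn (fun d => marginalRevenue h (F j) d t) (Icc 0 t))
    (hstar : (F j).StarGe (F i)) (hhi : (F j).hi = (F i).hi) : δ j ≤ δ i := by
  by_contra! hlt
  have h1 := hanti ⟨hsol.1 i, hsol.le i⟩ ⟨hsol.1 j, hsol.le j⟩ hlt
  simp only at h1
  rw [hsol.2.1 j, marginalRevenue_eq] at h1
  have hki := hk _ (exp_sub_mem_Ioc (hsol.le i))
  have hv : 0 ≤ (F j).virtualValue (Real.exp (-δ i)) :=
    (pos_of_mul_pos_left (hp.trans_lt h1) hki.le).le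
  have h2 := hstar.virtualValue_le hhi ⟨Real.exp_pos _, (exp_neg_mem (hsol.1 i)).2⟩ hv
  have h3 := mul_le_mul_of_nonneg_right h2 hki.le
  rw [← hsol.price_eq i] at h3
  linarith

/-- All bidders share the price, virtual value times `h'`. The bidder further along has the larger
`h'`, hence the smaller virtual value. -/
lemma SolvesSystem.virtualValue_le (hsol : SolvesSystem h F t δ p)
    (hk : ∀ y ∈ Ioc (0 : ℝ) 1, 0 < derivWithin h (Icc 0 1) y)
    (hkm : StrictMonoOn (derivWithin h (Icc 0 1)) (Icc 0 1)) (hp : 0 ≤ p) {i j : ι}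
    (hle : δ j ≤ δ i) :
    (F i).virtualValue (Real.exp (-δ i)) ≤ (F j).virtualValue (Real.exp (-δ j)) := by
  by_contra! hlt
  have hvi := (hsol.price_nonneg_iff hk i).1 hp
  have hkj := hk _ (exp_sub_mem_Ioc (hsol.le j))
  have h1 := hkm.monotoneOn (exp_sub_mem (hsol.le j)) (exp_sub_mem (hsol.le i))
    (Real.exp_le_exp.2 (sub_le_sub_right hle t))
  have h2 := mul_lt_mul_of_pos_right hlt hkj
  have h3 := mul_le_mul_of_nonneg_left h1 hvi
  rw [← hsol.price_eq j] at h2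
  rw [← hsol.price_eq i] at h3
  linarith

open Classical in
lemma SolvesSystem.prod_erase_exp (hsol : SolvesSystem h F t δ p) (i : ι) :
    ∏ j ∈ Finset.univ.erase i, Real.exp (-δ j) = Real.exp (-(t - δ i)) := by
  rw [← Real.exp_sum, Finset.sum_neg_distrib, Finset.sum_erase_eq_sub (Finset.mem_univ i),
    hsol.2.2]

end System

/-! ### The optimal reduced form -/

section Optimum

variable {ι : Type*} [Fintype ι] {h : ℝ → ℝ} {F : ι → TypeDist}

lemma continuousOn_price [Nonempty ι] {δ : ℝ → ι → ℝ} {p : ℝ → ℝ}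
    (hs : ContDiffOn ℝ 2 h (Icc 0 1)) (hsol : ∀ t, 0 ≤ t → SolvesSystem h F t (δ t) (p t))
    (hpath : ∀ i, IsPath fun t => δ t i) : ContinuousOn p (Ici 0) := by
  obtain ⟨i⟩ := ‹Nonempty ι›
  have hδ := (hpath i).continuousOn
  refine ContinuousOn.congr (f := fun t => (F i).virtualValue (Real.exp (-δ t i)) *
    derivWithin h (Icc 0 1) (Real.exp (δ t i - t))) ?_ fun t ht => (hsol t ht).price_eq i
  refine ContinuousOn.mul ?_ ?_
  · exact (F i).continuousOn_virtualValue.comp (f := fun t => Real.exp (-δ t i)) (by fun_prop)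
      fun t ht => exp_neg_mem ((hpath i).mem t ht).1
  · exact (continuousOn_derivWithin_of_contDiffOn hs).comp (f := fun t => Real.exp (δ t i - t))
      (by fun_prop) fun t ht => exp_sub_mem ((hpath i).mem t ht).2

/-- At time zero everyone sits at quantile `1`. As the price is common, all highest types coincide,
which the star order comparison needs. -/
lemma price_zero {δ : ℝ → ι → ℝ} {p : ℝ → ℝ} (hsol : ∀ t, 0 ≤ t → SolvesSystem h F t (δ t) (p t))
    (i : ι) : p 0 = (F i).hi * derivWithin h (Icc 0 1) 1 := by
  have h0 := hsol 0 le_rfl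
  have hδ : δ 0 i = 0 := le_antisymm (h0.le i) (h0.1 i)
  rw [h0.price_eq i, hδ, neg_zero, sub_zero, Real.exp_zero, (F i).virtualValue_one]

/-- The paths that solve the static system, stopped when the price reaches zero, are the crossing
paths of the unique optimal reduced form. -/
theorem exists_unique_optimal [Nonempty ι] {δ : ℝ → ι → ℝ} {p c : ℝ → ℝ}
    (hs : ContDiffOn ℝ 2 h (Icc 0 1)) (h1 : ∀ x ∈ Ioo (0 : ℝ) 1, 0 < deriv h x)
    (hk : ∀ y ∈ Ioc (0 : ℝ) 1, 0 < derivWithin h (Icc 0 1) y)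
    (hR : ∀ i, ∀ t : ℝ, 0 ≤ t → StrictConcaveOn ℝ (Icc 0 t) fun δ => R h (F i) δ t)
    (hsol : ∀ t, 0 ≤ t → SolvesSystem h F t (δ t) (p t))
    (hpath : ∀ i, IsPath fun t => δ t i) (hp : StrictAntiOn p (Ici 0)) (hc : IsPath c)
    (hpc : ∀ t, 0 ≤ t → 0 ≤ p (c t)) (hidle : ∀ t, 0 ≤ t → c t = t ∨ p (c t) = 0) :
    ∃ x : ι → ℝ → ℝ, Optimal h F x ∧
      (∀ y, Optimal h F y → ∀ i, EqOn (y i) (x i) (Icc 0 1)) ∧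
      ∀ i a b, 0 ≤ a → 0 ≤ b →
        (Real.exp (-b) ≤ x i (Real.exp (-a)) ↔ a ≤ δ (c (a + b)) i) := by
  choose x hx hcross hiff using fun i => ((hpath i).comp hc).exists_isCDF
  have hsum : ∀ t, 0 ≤ t → ∑ i, crossing (x i) t = c t := fun t ht => by
    rw [← (hsol (c t) (hc.mem t ht).1).2.2]
    exact Finset.sum_congr rfl fun i _ => hcross i t ht
  have hfeas : Feasible x :=
    ⟨hx, border_of_sum_crossing_le hx fun t ht => (hsum t ht).le.trans (hc.mem t ht).2⟩
  have hver := fun y (hy : Feasible y) => verification (y := y) hs h1 hR hx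
    (lam := fun t => p (c t))
    (fun a ha b hb hab => hp.antitoneOn (hc.mem a ha).1 (hc.mem b hb).1 (hc.mono ha hb hab))
    hpc ?_ ?_ hy
  · refine ⟨x, ⟨hfeas, fun y hy => (hver y hy).1⟩, fun y hy => ?_, hiff⟩
    exact (hver y hy.1).2 (hy.2 x hfeas)
  · intro t ht i
    have hct := hsol (c t) (hc.mem t ht).1
    rw [hcross i t ht]
    -- Once the clock stops, the price is zero; since `h' > 0`, the virtual value at the resting
    -- point is zero, so marginal revenue vanishes there at every later `t` too.
    rcases hidle t ht with he | he
    · simp only [he] at hct ⊢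
      exact hct.2.1 i
    · have h3 := hct.price_eq i
      rw [he] at h3 ⊢
      have h4 := (mul_eq_zero.1 h3.symm).resolve_right
        (hk _ (exp_sub_mem_Ioc (hct.le i))).ne'
      rw [marginalRevenue_eq, h4, zero_mul]
  · intro t ht
    rw [hsum t ht]
    rcases hidle t ht with he | he
    · rw [he]
    · simp only [he, zero_mul]

end Optimum

/-! ### Interim winning probabilities in Myerson's auction -/

section Myerson

/-- The probability that a bidder with type distribution `F` has a virtual value below `c`. -/
def virtualValueCDF (F : TypeDist) (c : ℝ) : ℝ :=
  volume.real {s | s ∈ Icc (0 : ℝ) 1 ∧ F.virtualValue s < c}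

lemma monotone_virtualValueCDF (F : TypeDist) : Monotone (virtualValueCDF F) := fun a b hab =>
  measureReal_mono (fun _ hs => ⟨hs.1, hs.2.trans_le hab⟩)
    (measure_ne_top_of_subset (fun _ hs => hs.1) (by simp : volume (Icc (0 : ℝ) 1) ≠ ⊤))

lemma virtualValueCDF_nonneg (F : TypeDist) (c : ℝ) : 0 ≤ virtualValueCDF F c :=
  measureReal_nonneg

variable {F : TypeDist} {b c : ℝ}

lemma le_virtualValueCDF (hF : StrictMonoOn F.virtualValue (Icc 0 1)) (hb : b ∈ Icc (0 : ℝ) 1)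
    (hc : F.virtualValue b ≤ c) : b ≤ virtualValueCDF F c := by
  have h1 : volume.real (Ico 0 b) = b := by simp [hb.1]
  rw [← h1]
  refine measureReal_mono (fun s hs => ?_)
    (measure_ne_top_of_subset (fun _ hs => hs.1) (by simp : volume (Icc (0 : ℝ) 1) ≠ ⊤))
  have hs1 : s ∈ Icc (0 : ℝ) 1 := ⟨hs.1, hs.2.le.trans hb.2⟩
  exact ⟨hs1, (hF hs1 hb hs.2).trans_le hc⟩

lemma virtualValueCDF_le (hF : StrictMonoOn F.virtualValue (Icc 0 1)) (hb : b ∈ Icc (0 : ℝ) 1)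
    (hc : c ≤ F.virtualValue b) : virtualValueCDF F c ≤ b := by
  have h1 : volume.real (Ico 0 b) = b := by simp [hb.1]
  refine (measureReal_mono (s₂ := Ico 0 b) (fun s hs => ⟨hs.1.1, ?_⟩) (by simp)).trans h1.le
  exact (hF.lt_iff_lt hs.1 hb).1 (hs.2.trans_le hc)

lemma virtualValueCDF_le_one (F : TypeDist) (c : ℝ) : virtualValueCDF F c ≤ 1 := by
  have h1 : volume.real (Icc (0 : ℝ) 1) = 1 := by simp
  rw [← h1]
  exact measureReal_mono (fun _ hs => hs.1) (by simp)

/-- A strictly increasing virtual value has no atoms, so even the CDF defined by a strict inequality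
is right-continuous. -/
lemma continuousWithinAt_virtualValueCDF (hF : StrictMonoOn F.virtualValue (Icc 0 1)) (c : ℝ) :
    ContinuousWithinAt (virtualValueCDF F) (Ici c) c := by
  refine tendsto_order.2 ⟨fun l hl => ?_, fun y hy => ?_⟩
  · filter_upwards [self_mem_nhdsWithin] with w hw
    exact hl.trans_le (monotone_virtualValueCDF F hw)
  · rcases lt_or_ge 1 y with hy1 | hy1
    · exact Eventually.of_forall fun w => (virtualValueCDF_le_one F w).trans_lt hy1
    · obtain ⟨b, hb1, hb2⟩ := exists_between hy
      have hb : b ∈ Icc (0 : ℝ) 1 :=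
        ⟨(virtualValueCDF_nonneg F c).trans hb1.le, hb2.le.trans hy1⟩
      have hlt : c < F.virtualValue b := by
        by_contra! hle
        exact absurd (le_virtualValueCDF hF hb hle) (not_le.2 hb1)
      filter_upwards [mem_nhdsWithin_of_mem_nhds (Iio_mem_nhds hlt)] with w hw
      exact (virtualValueCDF_le hF hb (le_of_lt hw)).trans_lt hb2

variable {ι : Type*} [Fintype ι] {F : ι → TypeDist}

open Classical in
/-- The interim winning probabilities in Myerson's auction. -/
lemma myersonReducedForm_eq (hF : ∀ i, StrictMonoOn (F i).virtualValue (Icc 0 1)) (i : ι) (w : ℝ) :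
    myersonReducedForm F i w = if 0 ≤ (F i).virtualValue w then
      ∏ j ∈ Finset.univ.erase i, virtualValueCDF (F j) ((F i).virtualValue w) else 0 := by
  unfold myersonReducedForm
  split_ifs with h0
  · set B : ι → Set ℝ := fun j =>
      {s | s ∈ Icc (0 : ℝ) 1 ∧ (F j).virtualValue s < (F i).virtualValue w} with hB
    set A : Set (ι → ℝ) := Set.pi univ fun j => if j = i then Icc (0 : ℝ) 1 else B j with hA
    have hBm : ∀ j, MeasurableSet (B j) := by
      intro j
      refine OrdConnected.measurableSet ⟨fun a ha b hb s hs => ?_⟩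
      have hs' : s ∈ Icc (0 : ℝ) 1 := ⟨ha.1.1.trans hs.1, hs.2.trans hb.1.2⟩
      exact ⟨hs', ((hF j).monotoneOn hs' hb.1 hs.2).trans_lt hb.2⟩
    have hAm : MeasurableSet A := by
      refine MeasurableSet.univ_pi fun j => ?_
      split_ifs
      · exact measurableSet_Icc
      · exact hBm j
    have hSm : MeasurableSet (Set.pi univ fun _ : ι => Icc (0 : ℝ) 1) :=
      MeasurableSet.univ_pi fun _ => measurableSet_Icc
    have hAS : A ⊆ Set.pi univ fun _ : ι => Icc (0 : ℝ) 1 := by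
      intro u hu j hj
      have := hu j hj
      by_cases hji : j = i
      · simpa [hji] using this
      · simp only [if_neg hji] at this
        exact this.1
    have hval : ∀ u ∈ Set.pi univ fun _ : ι => Icc (0 : ℝ) 1,
        myersonAlloc F (Function.update u i w) i = A.indicator (fun _ => (1 : ℝ)) u := by
      intro u hu
      have hiff : (0 ≤ (F i).mvv ((F i).quantile ((Function.update u i w) i)) ∧
          ∀ j, j ≠ i → (F j).mvv ((F j).quantile ((Function.update u i w) j)) <
            (F i).mvv ((F i).quantile ((Function.update u i w) i))) ↔ u ∈ A := by
        rw [Function.update_self]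
        constructor
        · rintro ⟨_, h2⟩ j hj
          by_cases hji : j = i
          · simpa [hji] using hu i (mem_univ i)
          · simp only [if_neg hji]
            have := h2 j hji
            rw [Function.update_of_ne hji] at this
            exact ⟨hu j hj, this⟩
        · intro hA
          refine ⟨h0, fun j hji => ?_⟩
          have := hA j (mem_univ j)
          simp only [if_neg hji] at this
          rw [Function.update_of_ne hji]
          exact this.2
      unfold myersonAlloc
      by_cases hA : u ∈ A
      · rw [if_pos (hiff.2 hA), indicator_of_mem hA]
      · rw [if_neg (mt hiff.1 hA), indicator_of_notMem hA]
    rw [setIntegral_congr_fun hSm hval, setIntegral_indicator hAm, inter_eq_right.2 hAS,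
      setIntegral_const, smul_eq_mul, mul_one, measureReal_def, hA, volume_pi_pi,
      ENNReal.toReal_prod, ← Finset.mul_prod_erase _ _ (Finset.mem_univ i)]
    simp only [if_true]
    rw [Real.volume_Icc, sub_zero, ENNReal.toReal_ofReal zero_le_one, one_mul]
    refine Finset.prod_congr rfl fun j hj => ?_
    rw [if_neg (Finset.ne_of_mem_erase hj)]
    rfl
  · have : ∀ u, myersonAlloc F (Function.update u i w) i = 0 := by
      intro u
      unfold myersonAlloc
      rw [if_neg]
      rw [Function.update_self]
      exact fun hh => h0 hh.1
    simp [this]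

lemma myersonReducedForm_nonneg (hF : ∀ i, StrictMonoOn (F i).virtualValue (Icc 0 1)) (i : ι)
    (w : ℝ) : 0 ≤ myersonReducedForm F i w := by
  rw [myersonReducedForm_eq hF]
  split_ifs
  · exact Finset.prod_nonneg fun j _ => virtualValueCDF_nonneg _ _
  · exact le_rfl

lemma monotoneOn_myersonReducedForm (hF : ∀ i, StrictMonoOn (F i).virtualValue (Icc 0 1)) (i : ι) :
    MonotoneOn (myersonReducedForm F i) (Icc 0 1) := by
  intro a ha b hb hab
  have hv := (hF i).monotoneOn ha hb hab
  by_cases h0 : 0 ≤ (F i).virtualValue a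
  · rw [myersonReducedForm_eq hF, myersonReducedForm_eq hF, if_pos h0, if_pos (h0.trans hv)]
    exact Finset.prod_le_prod (fun j _ => virtualValueCDF_nonneg _ _)
      fun j _ => monotone_virtualValueCDF _ hv
  · rw [myersonReducedForm_eq hF, if_neg h0]
    exact myersonReducedForm_nonneg hF i b

/-- Quantile `0` lies at infinity in logarithmic coordinates, so the comparison there is a limit of
comparisons at positive quantiles. -/
lemma tendsto_myersonReducedForm_zero (hF : ∀ i, StrictMonoOn (F i).virtualValue (Icc 0 1))
    (i : ι) : Tendsto (myersonReducedForm F i) (𝓝[>] 0) (𝓝 (myersonReducedForm F i 0)) := by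
  have hI : ∀ᶠ w in 𝓝[>] (0 : ℝ), w ∈ Ioo (0 : ℝ) 1 := Ioo_mem_nhdsGT one_pos
  have hle : 𝓝[>] (0 : ℝ) ≤ 𝓝[Icc 0 1] 0 := by
    rw [← nhdsWithin_Ioo_eq_nhdsGT (zero_lt_one (α := ℝ))]
    exact nhdsWithin_mono _ Ioo_subset_Icc_self
  have hv : Tendsto (F i).virtualValue (𝓝[>] 0) (𝓝 ((F i).virtualValue 0)) :=
    ((F i).continuousOn_virtualValue 0 (by simp)).mono_left hle
  have hge : ∀ᶠ w in 𝓝[>] (0 : ℝ), (F i).virtualValue 0 ≤ (F i).virtualValue w := by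
    filter_upwards [hI] with w hw
    exact (hF i).monotoneOn (by simp) (Ioo_subset_Icc_self hw) hw.1.le
  by_cases h0 : 0 ≤ (F i).virtualValue 0
  · rw [myersonReducedForm_eq hF, if_pos h0]
    have hv' : Tendsto (F i).virtualValue (𝓝[>] 0) (𝓝[≥] ((F i).virtualValue 0)) :=
      tendsto_nhdsWithin_iff.2 ⟨hv, hge⟩
    refine (tendsto_finsetProd _ fun j _ =>
      (continuousWithinAt_virtualValueCDF (hF j) ((F i).virtualValue 0)).tendsto.comp hv').congr' ?_
    filter_upwards [hge] with w hw
    rw [myersonReducedForm_eq hF, if_pos (h0.trans hw)]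
    rfl
  · rw [myersonReducedForm_eq hF, if_neg h0]
    refine tendsto_const_nhds.congr' ?_
    filter_upwards [hv.eventually_lt_const (not_le.1 h0)] with w hw
    rw [myersonReducedForm_eq hF, if_neg (not_le.2 hw)]

lemma IsCDF.tendsto_zero {x : ℝ → ℝ} (hx : IsCDF x) : Tendsto x (𝓝[>] 0) (𝓝 (x 0)) :=
  (hx.2.1 0 (by simp)).mono_left (nhdsWithin_mono _ Ioi_subset_Ici_self)

end Myerson

/-! ### Comparing the optimum with Myerson's auction -/

section Comparison

variable {ι : Type*} [Fintype ι] {h : ℝ → ℝ} {F : ι → TypeDist} {δ : ℝ → ι → ℝ} {p c : ℝ → ℝ}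

/-- A bidder who is always the fastest at nonnegative prices is favored relative to Myerson's
auction. -/
theorem myersonReducedForm_le (hk : ∀ y ∈ Ioc (0 : ℝ) 1, 0 < derivWithin h (Icc 0 1) y)
    (hkm : StrictMonoOn (derivWithin h (Icc 0 1)) (Icc 0 1))
    (hF : ∀ i, StrictMonoOn (F i).virtualValue (Icc 0 1))
    (hsol : ∀ t, 0 ≤ t → SolvesSystem h F t (δ t) (p t))
    (hpath : ∀ i, IsPath fun t => δ t i) (hrun : ∀ t, 0 ≤ t → 0 ≤ p t → c t = t) {i : ι}
    (hfast : ∀ t, 0 ≤ t → 0 ≤ p t → ∀ j, δ t j ≤ δ t i) {x : ℝ → ℝ} (hx : IsCDF x)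
    (hiff : ∀ a b, 0 ≤ a → 0 ≤ b →
      (Real.exp (-b) ≤ x (Real.exp (-a)) ↔ a ≤ δ (c (a + b)) i)) {u : ℝ}
    (hu : u ∈ Icc (0 : ℝ) 1) : myersonReducedForm F i u ≤ x u := by
  classical
  have hpos : ∀ u ∈ Ioc (0 : ℝ) 1, myersonReducedForm F i u ≤ x u := by
    intro u hu
    have hu' := Ioc_subset_Icc_self hu
    by_cases h0 : 0 ≤ (F i).virtualValue u
    · set a : ℝ := -Real.log u with ha
      have ha0 : 0 ≤ a := neg_nonneg.2 (Real.log_nonpos hu'.1 hu.2)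
      have hua : Real.exp (-a) = u := by rw [ha, neg_neg, Real.exp_log hu.1]
      -- If `a` were never reached, the price would stay nonnegative and `i` the fastest; at time
      -- `card ι * a` all coordinates would be below `a`, contradicting their sum.
      have hreach : ∃ s, 0 ≤ s ∧ a ≤ δ s i := by
        by_contra! hlt
        have hprice : ∀ s, 0 ≤ s → 0 ≤ p s := by
          intro s hs
          rw [(hsol s hs).price_nonneg_iff hk i]
          refine h0.trans ((hF i).monotoneOn hu' (exp_neg_mem ((hsol s hs).1 i)) ?_)
          rw [← hua]
          exact Real.exp_le_exp.2 (neg_le_neg (hlt s hs).le)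
        set s : ℝ := Fintype.card ι * a with hs
        have hs0 : 0 ≤ s := by positivity
        have h1 : ∑ j, δ s j < ∑ _j : ι, a :=
          Finset.sum_lt_sum_of_nonempty ⟨i, Finset.mem_univ i⟩ fun j _ =>
            (hfast s hs0 (hprice s hs0) j).trans_lt (hlt s hs0)
        rw [(hsol s hs0).2.2, Finset.sum_const, nsmul_eq_mul, Finset.card_univ] at h1
        exact lt_irrefl _ h1
      obtain ⟨s, hs0, hs⟩ := hreach
      obtain ⟨t, ht, hta⟩ := intermediate_value_Icc hs0
        ((hpath i).continuousOn.mono Icc_subset_Ici_self) (show a ∈ Icc (δ 0 i) (δ s i) from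
          ⟨(hpath i).zero.le.trans ha0, hs⟩)
      simp only at hta
      have hst := hsol t ht.1
      have hpt : 0 ≤ p t := by
        rw [hst.price_nonneg_iff hk i, hta, hua]
        exact h0
      have hat : 0 ≤ t - a := by
        rw [← hta]
        exact sub_nonneg.2 (hst.le i)
      have hlow := (hiff a (t - a) ha0 hat).2 (by
        rw [add_sub_cancel, hrun t ht.1 hpt, hta])
      rw [hua] at hlow
      refine le_trans ?_ hlow
      rw [myersonReducedForm_eq hF, if_pos h0, ← hta, ← hst.prod_erase_exp i]
      refine Finset.prod_le_prod (fun j _ => virtualValueCDF_nonneg _ _) fun j _ => ?_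
      refine virtualValueCDF_le (hF j) (exp_neg_mem (hst.1 j)) ?_
      have h2 := hst.virtualValue_le hk hkm hpt (hfast t ht.1 hpt j)
      rwa [hta, hua] at h2
    · rw [myersonReducedForm_eq hF, if_neg h0]
      exact (hx.mem_Icc hu').1
  rcases hu.1.eq_or_lt with rfl | hu0
  · refine ge_of_tendsto hx.tendsto_zero ?_
    filter_upwards [Ioo_mem_nhdsGT (zero_lt_one (α := ℝ))] with w hw
    exact (monotoneOn_myersonReducedForm hF i (by simp) (Ioo_subset_Icc_self hw) hw.1.le).trans
      (hpos w ⟨hw.1, hw.2.le⟩)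
  · exact hpos u ⟨hu0, hu.2⟩

/-- A bidder who is always the slowest at nonnegative prices is discriminated against relative to
Myerson's auction. -/
theorem le_myersonReducedForm (hk : ∀ y ∈ Ioc (0 : ℝ) 1, 0 < derivWithin h (Icc 0 1) y)
    (hkm : StrictMonoOn (derivWithin h (Icc 0 1)) (Icc 0 1))
    (hF : ∀ i, StrictMonoOn (F i).virtualValue (Icc 0 1))
    (hsol : ∀ t, 0 ≤ t → SolvesSystem h F t (δ t) (p t))
    (hpath : ∀ i, IsPath fun t => δ t i) (hp : AntitoneOn p (Ici 0)) (hc : IsPath c)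
    (hpc : ∀ t, 0 ≤ t → 0 ≤ p (c t)) {i : ι}
    (hslow : ∀ t, 0 ≤ t → 0 ≤ p t → ∀ j, δ t i ≤ δ t j) {x : ℝ → ℝ} (hx : IsCDF x)
    (hiff : ∀ a b, 0 ≤ a → 0 ≤ b →
      (Real.exp (-b) ≤ x (Real.exp (-a)) ↔ a ≤ δ (c (a + b)) i)) {u : ℝ}
    (hu : u ∈ Icc (0 : ℝ) 1) : x u ≤ myersonReducedForm F i u := by
  classical
  have hpos : ∀ u ∈ Ioc (0 : ℝ) 1, x u ≤ myersonReducedForm F i u := by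
    intro u hu
    have hxu := hx.mem_Icc (Ioc_subset_Icc_self hu)
    rcases hxu.1.eq_or_lt with hx0 | hx0
    · rw [← hx0]
      exact myersonReducedForm_nonneg hF i u
    · set a : ℝ := -Real.log u with ha
      set b : ℝ := -Real.log (x u) with hb
      have ha0 : 0 ≤ a := neg_nonneg.2 (Real.log_nonpos hu.1.le hu.2)
      have hb0 : 0 ≤ b := neg_nonneg.2 (Real.log_nonpos hxu.1 hxu.2)
      have hua : Real.exp (-a) = u := by rw [ha, neg_neg, Real.exp_log hu.1]
      have hxb : Real.exp (-b) = x u := by rw [hb, neg_neg, Real.exp_log hx0]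
      have hs := (hiff a b ha0 hb0).1 (by rw [hxb, hua])
      have hcm := hc.mem (a + b) (add_nonneg ha0 hb0)
      -- The time `t` at which the path hits `a` satisfies `t ≤ c (a + b) ≤ a + b`, so the price is
      -- still nonnegative and `e^(-b) ≤ e^(-(t - a))`.
      obtain ⟨t, ht, hta⟩ := intermediate_value_Icc hcm.1
        ((hpath i).continuousOn.mono Icc_subset_Ici_self)
        (show a ∈ Icc (δ 0 i) (δ (c (a + b)) i) from ⟨(hpath i).zero.le.trans ha0, hs⟩)
      simp only at hta
      have hst := hsol t ht.1
      have hpt : 0 ≤ p t := (hpc _ (add_nonneg ha0 hb0)).trans (hp ht.1 hcm.1 ht.2)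
      have h0 : 0 ≤ (F i).virtualValue u := by
        rw [← hua, ← hta]
        exact (hst.price_nonneg_iff hk i).1 hpt
      have hle : x u ≤ Real.exp (-(t - δ t i)) := by
        rw [← hxb, hta]
        exact Real.exp_le_exp.2 (by linarith [ht.2, hcm.2])
      refine hle.trans ?_
      rw [myersonReducedForm_eq hF, if_pos h0, ← hst.prod_erase_exp i]
      refine Finset.prod_le_prod (fun j _ => (Real.exp_pos _).le) fun j _ => ?_
      refine le_virtualValueCDF (hF j) (exp_neg_mem (hst.1 j)) ?_
      have h2 := hst.virtualValue_le hk hkm hpt (hslow t ht.1 hpt j)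
      rwa [hta, hua] at h2
  rcases hu.1.eq_or_lt with rfl | hu0
  · refine le_of_tendsto_of_tendsto hx.tendsto_zero (tendsto_myersonReducedForm_zero hF i) ?_
    filter_upwards [Ioo_mem_nhdsGT (zero_lt_one (α := ℝ))] with w hw
    exact hpos w ⟨hw.1, hw.2.le⟩
  · exact hpos u ⟨hu0, hu.2⟩

end Comparison

end

end EVAuction

theorem proposition4 (n : ℕ) (F : Fin (n + 1) → EVAuction.TypeDist) (h : ℝ → ℝ)
    (h_smooth : ContDiffOn ℝ 2 h (Set.Icc 0 1))
    (h_deriv : ∀ x ∈ Set.Ioo (0 : ℝ) 1, 0 < deriv h x)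
    (h_deriv2 : ∀ x ∈ Set.Ioo (0 : ℝ) 1, 0 < deriv (deriv h) x)
    (mvv_strictMono : ∀ i, StrictMonoOn (F i).mvv (Set.Icc (F i).lo (F i).hi))
    (regular : EVAuction.Regular h F)
    (hr : ∀ i, (F 0).HrGe (F i) ∧ (F i).HrGe (F (Fin.last n)))
    (star : ∀ i, (F (Fin.last n)).StarGe (F i) ∧ (F i).StarGe (F 0)) :
    ∃ x : Fin (n + 1) → ℝ → ℝ,
      EVAuction.Optimal h F x ∧
      (∀ y, EVAuction.Optimal h F y → ∀ i, Set.EqOn (y i) (x i) (Set.Icc 0 1)) ∧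
      (∀ u ∈ Set.Icc (0 : ℝ) 1, EVAuction.myersonReducedForm F 0 u ≤ x 0 u) ∧
      (∀ u ∈ Set.Icc (0 : ℝ) 1,
        x (Fin.last n) u ≤ EVAuction.myersonReducedForm F (Fin.last n) u) := by
  obtain ⟨hR, δ, p, hsys, hmono, hp⟩ := regular
  have hsol : ∀ t, 0 ≤ t → EVAuction.SolvesSystem h F t (δ t) (p t) := fun t ht => (hsys t ht).1
  have hk : ∀ y ∈ Set.Ioc (0 : ℝ) 1, 0 < derivWithin h (Set.Icc 0 1) y := fun y hy =>
    EVAuction.derivWithin_pos h_smooth h_deriv h_deriv2 hy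
  have hkm := EVAuction.strictMonoOn_derivWithin h_smooth h_deriv2
  have hF := fun i => EVAuction.TypeDist.strictMonoOn_virtualValue (mvv_strictMono i)
  have hpath := EVAuction.isPath_of_solvesSystem hsol fun i => (hmono i).monotoneOn
  have hk1 := hk 1 (by simp)
  have hp0 : 0 ≤ p 0 := by
    rw [EVAuction.price_zero hsol 0]
    exact mul_nonneg ((F 0).lo_nonneg.trans (F 0).lo_lt_hi.le) hk1.le
  have hhi : ∀ i j, (F i).hi = (F j).hi := fun i j => by
    have := EVAuction.price_zero hsol i
    rw [EVAuction.price_zero hsol j] at this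
    exact (mul_right_cancel₀ hk1.ne' this).symm
  obtain ⟨c, hc, hpc, hidle, hrun⟩ :=
    EVAuction.exists_clock hp (EVAuction.continuousOn_price h_smooth hsol hpath) hp0
  obtain ⟨x, hopt, huniq, hiff⟩ := EVAuction.exists_unique_optimal h_smooth h_deriv hk hR hsol
    hpath hp hc hpc hidle
  have hle : ∀ i j, (F j).StarGe (F i) → ∀ t, 0 ≤ t → 0 ≤ p t → δ t j ≤ δ t i :=
    fun i j hij t ht hpt => (hsol t ht).le_of_starGe hk hpt
      (EVAuction.strictAntiOn_marginalRevenue h_smooth (hR j t ht)) hij (hhi j i)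
  refine ⟨x, hopt, huniq, fun u hu => ?_, fun u hu => ?_⟩
  · exact EVAuction.myersonReducedForm_le hk hkm hF hsol hpath hrun
      (fun t ht hpt j => hle 0 j (star j).2 t ht hpt) (hopt.1.1 0) (hiff 0) hu
  · exact EVAuction.le_myersonReducedForm hk hkm hF hsol hpath hp.antitoneOn hc hpc
      (fun t ht hpt j => hle j (Fin.last n) (star j).1 t ht hpt) (hopt.1.1 _) (hiff _) hu
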